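/- Let $F:\Omega\to\Omega$ be a measure-preserving map of a measure space $(\Omega,\omega)$, and let $\mathcal K g=g\circ F$ be its Koopman operator, an isometry of $L^2(\Omega,\omega)$ (inner product $\langle\cdot,\cdot\rangle$ linear in the first argument). Let $\mathcal K'$ be a unitary extension of $\mathcal K$ to a Hilbert space $\mathcal H'\supseteq L^2(\Omega,\omega)$, let $\mathcal E'$ be the projection-valued spectral measure of $\mathcal K'$ on the unit circle $\mathbb T$, and let $\mathcal E$ be its compression to $L^2(\Omega,\omega)$ (which does not depend on the extension). For $g\in L^2(\Omega,\omega)$ with $\|g\|=1$, let $\mu_g(S)=\langle\mathcal E(S)g,g\rangle$ for Borel sets $S\subseteq\mathbb T$. Let $\psi_1,\dots,\psi_N\in L^2(\Omega,\omega)$ be a dictionary of functions, $x^{(1)},\dots,x^{(M)}\in\Omega$ be nodes with weights $w_1,\dots,w_M\ge 0$, and $y^{(m)}=F(x^{(m)})$. Put $\Psi_X=(\psi_j(x^{(m)}))_{m,j}$, $\Psi_Y=(\psi_j(y^{(m)}))_{m,j}\in\mathbb C^{M\times N}$, $W=\mathrm{diag}(w_1,\dots,w_M)$, $G=\Psi_X^*W\Psi_X$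 and $A=\Psi_X^*W\Psi_Y$, and assume that $G$ is invertible. Let $G^{-1/2}A^*G^{-1/2}=U_1\Sigma U_2^*$ be any singular value decomposition and $U_2U_1^*=\hat V\,\mathrm{diag}(\lambda_1,\dots,\lambda_N)\,\hat V^*$ any eigendecomposition with $\hat V$ unitary. Let $\mathbb K=G^{-1/2}U_2U_1^*G^{1/2}$ and let $v_1,\dots,v_N$ be the columns of $G^{-1/2}\hat V$ (eigenvectors of $\mathbb K$, with eigenvalues $\lambda_j\in\mathbb T$). For $\boldsymbol g\in\mathbb C^N$ with $\boldsymbol g^*G\boldsymbol g=1$, let $\mu_{\boldsymbol g}^{(N,M)}=\sum_{j=1}^N|v_j^*G\boldsymbol g|^2\delta_{\lambda_j}$. For Borel probability measures $\mu,\nu$ on $\mathbb T$ let $W_1(\mu,\nu)=\sup_\phi\int_{\mathbb T}\phi\,d(\mu-\nu)$, the supremum being over all $\phi:\mathbb T\to\mathbb R$ with Lipschitz constant at most $1$. Then there is a universal constant $C$ such that, for all such data, for every integer $L\ge 2$, every $g\in L^2(\Omega,\omega)$ with $\|g\|=1$, and every $\boldsymbol g\in\mathbb C^N$ with $\boldsymbol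 g^*G\boldsymbol g=1$, $$ W_1\left(\mu_g,\mu_{\boldsymbol g}^{(N,M)}\right)\le C\left(\frac{\log L}{L}+\sum_{l=1}^{L}\frac{\left|\langle\mathcal K^{l}g,g\rangle-\boldsymbol g^*G\mathbb K^{l}\boldsymbol g\right|}{l}\right). $$ -/

import Mathlib

open MeasureTheory

noncomputable section

open Filter Topology

open scoped ComplexInnerProductSpace

set_option linter.unusedSectionVars false

namespace MpEDMD

instance instMeasurableSpaceCircle : MeasurableSpace Circle := borel Circle

instance instBorelSpaceCircle : BorelSpace Circle := ⟨rfl⟩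

universe u

/-- A normalized positive-operator-valued Borel measure on the unit circle `𝕋`. -/
structure OperatorMeasure (H : Type u) [NormedAddCommGroup H] [InnerProductSpace ℂ H] where
  toFun : Set Circle → H →L[ℂ] H
  isPositive : ∀ S, MeasurableSet S → (toFun S).IsPositive
  map_univ : toFun Set.univ = 1
  hasSum_iUnion : ∀ S : ℕ → Set Circle, (∀ i, MeasurableSet (S i)) →
    Pairwise (Function.onFun Disjoint S) → ∀ x y : H,
      HasSum (fun i => ⟪x, toFun (S i) y⟫) ⟪x, toFun (⋃ i, S i) y⟫

namespace OperatorMeasure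

variable {H : Type u} [NormedAddCommGroup H] [InnerProductSpace ℂ H]

theorem apply_empty (E : OperatorMeasure H) (x : H) : ⟪x, E.toFun ∅ x⟫ = 0 := by
  have h := E.hasSum_iUnion (fun _ => ∅) (fun _ => .empty) (fun _ _ _ => by simp) x x
  simpa using tendsto_nhds_unique h.summable.tendsto_atTop_zero tendsto_const_nhds |>.symm

/-- The scalar measure `S ↦ ⟨E(S) x, x⟩` (a nonnegative real number, as `E(S)` is positive). -/
def scalar (E : OperatorMeasure H) (x : H) : Measure Circle :=
  Measure.ofMeasurable (fun S _ => ENNReal.ofReal (⟪x, E.toFun S x⟫).re)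
    (by simp [apply_empty])
    (by
      intro S hS hd
      have h := Complex.reCLM.hasSum (E.hasSum_iUnion S hS hd x x)
      simp only [Complex.reCLM_apply] at h
      rw [← h.tsum_eq, ENNReal.ofReal_tsum_of_nonneg]
      · intro n
        exact (E.isPositive _ (hS n)).re_inner_nonneg_right x
      · exact h.summable)

/-- `E` is a projection-valued measure: every `E(S)` is an orthogonal projection. -/
def IsProjectionValued [CompleteSpace H] (E : OperatorMeasure H) : Prop :=
  ∀ S, MeasurableSet S → IsStarProjection (E.toFun S)

/-- `T = ∫_𝕋 λ dE(λ)`, in the weak sense; by polarization it is enough to say this on the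
diagonal. -/
def Represents (E : OperatorMeasure H) (T : H →L[ℂ] H) : Prop :=
  ∀ x : H, ⟪x, T x⟫ = ∫ z, (z : ℂ) ∂(E.scalar x)

/-- The compression `ι* E'(·) ι` of an operator-valued measure to a subspace,
embedded by the isometry `ι`. -/
def compress {H' : Type u} [NormedAddCommGroup H'] [InnerProductSpace ℂ H'] [CompleteSpace H]
    [CompleteSpace H'] (E' : OperatorMeasure H') (ι : H →ₗᵢ[ℂ] H') : OperatorMeasure H where
  toFun S := ContinuousLinearMap.adjoint ι.toContinuousLinearMap ∘L E'.toFun S ∘L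
    ι.toContinuousLinearMap
  isPositive S hS := by
    simpa using (E'.isPositive S hS).conj_adjoint
      (ContinuousLinearMap.adjoint ι.toContinuousLinearMap)
  map_univ := by
    ext x
    rw [E'.map_univ]
    refine ext_inner_left ℂ fun y => ?_
    simp [ContinuousLinearMap.adjoint_inner_right]
  hasSum_iUnion S hS hd x y := by
    simpa [ContinuousLinearMap.adjoint_inner_right] using E'.hasSum_iUnion S hS hd (ι x) (ι y)

end OperatorMeasure

section Existence

variable {H : Type u} [NormedAddCommGroup H] [InnerProductSpace ℂ H] [CompleteSpace H]

theorem exists_weak_limit (T : ℕ → H →L[ℂ] H) (hT : ∀ n, ‖T n‖ ≤ 1) (q : H → ℂ)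
    (h : ∀ x, Tendsto (fun n => ⟪x, T n x⟫) atTop (𝓝 (q x))) :
    ∃ A : H →L[ℂ] H, ∀ x y, Tendsto (fun n => ⟪x, T n y⟫) atTop (𝓝 ⟪x, A y⟫) := by
  have hex : ∀ x y, ∃ b, Tendsto (fun n => ⟪x, T n y⟫) atTop (𝓝 b) := by
    intro x y
    have h' : ∀ x, Tendsto (fun n => ⟪T n x, x⟫) atTop (𝓝 (starRingEnd ℂ (q x))) := by
      intro x
      have := (Complex.continuous_conj.tendsto _).comp (h x)
      simpa [Function.comp_def] using this
    have h2 := (((h' (y + x)).sub (h' (y - x))).sub ((h' (y + Complex.I • x)).const_mul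
      Complex.I)).add ((h' (y - Complex.I • x)).const_mul Complex.I)
    have h3 := h2.div_const 4
    have h4 := (Complex.continuous_conj.tendsto _).comp h3
    refine ⟨_, h4.congr fun n => ?_⟩
    have := inner_map_polarization' (T n : H →ₗ[ℂ] H) y x
    simp only [ContinuousLinearMap.coe_coe] at this
    simp only [Function.comp_def]
    rw [← this, inner_conj_symm]
  choose b hb using hex
  let B : H →ₗ⋆[ℂ] H →ₗ[ℂ] ℂ := LinearMap.mk₂'ₛₗ (starRingEnd ℂ) (RingHom.id ℂ) b
    (fun x x' y => tendsto_nhds_unique (hb _ _)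
      (((hb x y).add (hb x' y)).congr fun n => by simp))
    (fun c x y => tendsto_nhds_unique (hb _ _)
      (((hb x y).const_mul (starRingEnd ℂ c)).congr fun n => by simp [mul_comm]))
    (fun x y y' => tendsto_nhds_unique (hb _ _)
      (((hb x y).add (hb x y')).congr fun n => by simp))
    (fun c x y => tendsto_nhds_unique (hb _ _)
      (((hb x y).const_mul c).congr fun n => by simp))
  have hB : ∀ x y, ‖B x y‖ ≤ 1 * ‖x‖ * ‖y‖ := by
    intro x y
    refine le_of_tendsto (hb x y).norm (Eventually.of_forall fun n => ?_)
    calc ‖⟪x, T n y⟫‖ ≤ ‖x‖ * ‖T n y‖ := norm_inner_le_norm _ _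
      _ ≤ ‖x‖ * (1 * ‖y‖) := by
        gcongr
        exact (T n).le_of_opNorm_le (hT n) y
      _ = _ := by ring
  let B' : H →L⋆[ℂ] H →L[ℂ] ℂ := LinearMap.mkContinuous₂ B 1 hB
  refine ⟨ContinuousLinearMap.adjoint (InnerProductSpace.continuousLinearMapOfBilin B'),
    fun x y => ?_⟩
  rw [ContinuousLinearMap.adjoint_inner_right,
    InnerProductSpace.continuousLinearMapOfBilin_apply]
  exact hb x y

theorem eq_of_inner_self_eq {S T : H →L[ℂ] H} (h : ∀ x, ⟪x, S x⟫ = ⟪x, T x⟫) : S = T := by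
  have := (ext_inner_map (S : H →ₗ[ℂ] H) (T : H →ₗ[ℂ] H)).1 fun x => by
    have := congrArg (starRingEnd ℂ) (h x)
    simpa using this
  ext x
  exact congrArg (fun f : H →ₗ[ℂ] H => f x) this

theorem isSelfAdjoint_of_inner_real {T : H →L[ℂ] H} (q : H → ℝ) (h : ∀ x, ⟪x, T x⟫ = (q x : ℂ)) :
    IsSelfAdjoint T := by
  rw [ContinuousLinearMap.isSelfAdjoint_iff_isSymmetric,
    LinearMap.isSymmetric_iff_inner_map_self_real]
  intro v
  have hv : ⟪T v, v⟫ = (q v : ℂ) := by rw [← inner_conj_symm, h]; simp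
  simp [hv]

theorem norm_sq_projection {P : H →L[ℂ] H} (hP : IsStarProjection P) (x y : H) :
    ⟪P x, P y⟫ = ⟪x, P y⟫ := by
  have h1 : ContinuousLinearMap.adjoint P = P := hP.isSelfAdjoint
  have h2 : P (P y) = P y := congrArg (fun f : H →L[ℂ] H => f y) hP.isIdempotentElem
  rw [← ContinuousLinearMap.adjoint_inner_right, h1, h2]

/-- The continuous functional calculus of a unitary operator on functions on the circle. -/
theorem exists_circle_calculus (U : H ≃ₗᵢ[ℂ] H) : ∃ Φ : C(Circle, ℂ) →⋆ₐ[ℂ] (H →L[ℂ] H),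
    Φ ⟨fun z => (z : ℂ), by fun_prop⟩ = (U : H →L[ℂ] H) := by
  let V := Unitary.linearIsometryEquiv.symm U
  have hV : (V : H →L[ℂ] H) = (U : H →L[ℂ] H) := by
    ext x; rfl
  have hn : IsStarNormal (V : H →L[ℂ] H) := inferInstance
  let r : C(spectrum ℂ (V : H →L[ℂ] H), Circle) :=
    ⟨fun z => ⟨z.1, by
      have := spectrum.subset_circle_of_unitary V.2 z.2
      simpa [Submonoid.unitSphere] using this⟩,
      by exact Continuous.subtype_mk continuous_subtype_val _⟩
  refine ⟨(cfcHom (R := ℂ) hn).comp (ContinuousMap.compStarAlgHom' ℂ ℂ r), ?_⟩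
  rw [← hV]
  conv_rhs => rw [← cfcHom_id (R := ℂ) hn]
  rfl


/-- A real continuous function, seen as a complex one. -/
def toComplexMap (f : C(Circle, ℝ)) : C(Circle, ℂ) := ⟨fun z => (f z : ℂ), by fun_prop⟩

theorem inner_toComplexMap_sq (Φ : C(Circle, ℂ) →⋆ₐ[ℂ] (H →L[ℂ] H)) (f : C(Circle, ℝ)) (x : H) :
    ⟪x, Φ (toComplexMap (f * f)) x⟫ = ((‖Φ (toComplexMap f) x‖ ^ 2 : ℝ) : ℂ) := by
  have h1 : toComplexMap (f * f) = star (toComplexMap f) * toComplexMap f := by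
    ext z
    simp [toComplexMap]
  rw [h1, map_mul, map_star, ContinuousLinearMap.star_eq_adjoint]
  simp only [mul_apply_eq_comp, ContinuousLinearMap.adjoint_inner_right]
  rw [inner_self_eq_norm_sq_to_K]
  simp

theorem isSelfAdjoint_toComplexMap (Φ : C(Circle, ℂ) →⋆ₐ[ℂ] (H →L[ℂ] H)) (f : C(Circle, ℝ)) :
    IsSelfAdjoint (Φ (toComplexMap f)) := by
  rw [IsSelfAdjoint, ← map_star]
  congr 1
  ext z
  simp [toComplexMap]

theorem exists_scalar_measure (Φ : C(Circle, ℂ) →⋆ₐ[ℂ] (H →L[ℂ] H)) (x : H) :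
    ∃ μ : Measure Circle, IsFiniteMeasure μ ∧
      ∀ f : C(Circle, ℝ), ⟪x, Φ (toComplexMap f) x⟫ = ((∫ z, f z ∂μ : ℝ) : ℂ) := by
  let L : CompactlySupportedContinuousMap Circle ℝ →ₗ[ℝ] ℝ :=
    { toFun := fun f => (⟪x, Φ (toComplexMap f) x⟫).re
      map_add' := by
        intro f g
        have : toComplexMap (f + g : CompactlySupportedContinuousMap Circle ℝ)
            = toComplexMap f + toComplexMap g := by
          ext z
          simp [toComplexMap]
        simp [this]
      map_smul' := by
        intro c f
        have : toComplexMap (c • f : CompactlySupportedContinuousMap Circle ℝ)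
            = (c : ℂ) • toComplexMap f := by
          ext z
          simp [toComplexMap]
        rw [this, map_smul]
        simp }
  let Λ : CompactlySupportedContinuousMap Circle ℝ →ₚ[ℝ] ℝ := PositiveLinearMap.mk₀ L (by
    intro f hf
    let g : C(Circle, ℝ) := ⟨fun z => Real.sqrt (f z), by fun_prop⟩
    have hg : toComplexMap f = toComplexMap (g * g) := by
      ext z
      have : Real.sqrt (f z) * Real.sqrt (f z) = f z := Real.mul_self_sqrt (hf z)
      simp only [toComplexMap, ContinuousMap.coe_mk, ContinuousMap.mul_apply, g, this]
    change 0 ≤ (⟪x, Φ (toComplexMap f) x⟫).re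
    rw [hg, inner_toComplexMap_sq, Complex.ofReal_re]
    positivity)
  refine ⟨RealRMK.rieszMeasure Λ, inferInstance, fun f => ?_⟩
  have h := RealRMK.integral_rieszMeasure Λ (CompactlySupportedContinuousMap.continuousMapEquiv f)
  have h2 : Λ (CompactlySupportedContinuousMap.continuousMapEquiv f)
      = (⟪x, Φ (toComplexMap f) x⟫).re := rfl
  rw [h2] at h
  have h3 : ∫ z, f z ∂(RealRMK.rieszMeasure Λ) = (⟪x, Φ (toComplexMap f) x⟫).re := h
  rw [h3]
  have hs := (ContinuousLinearMap.isSelfAdjoint_iff_isSymmetric.1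
    (isSelfAdjoint_toComplexMap Φ f))
  have := hs.coe_re_inner_self_apply x
  simp only [ContinuousLinearMap.coe_coe] at this
  exact this.symm

theorem exists_projection (Φ : C(Circle, ℂ) →⋆ₐ[ℂ] (H →L[ℂ] H)) (μ : H → Measure Circle)
    [∀ x, IsFiniteMeasure (μ x)]
    (hμ : ∀ x, ∀ f : C(Circle, ℝ), ⟪x, Φ (toComplexMap f) x⟫ = ((∫ z, f z ∂(μ x) : ℝ) : ℂ))
    (S : Set Circle) (hS : MeasurableSet S) :
    ∃ P : H →L[ℂ] H, IsStarProjection P ∧ ∀ x, ⟪x, P x⟫ = ((μ x).real S : ℂ) := by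
  have huniv : ∀ x, ⟪x, x⟫ = ((μ x).real Set.univ : ℂ) := by
    intro x
    have h1 : toComplexMap 1 = 1 := by ext z; simp [toComplexMap]
    have := hμ x 1
    simpa [h1] using this
  induction S, hS using MeasurableSpace.induction_on_inter
    (borel_eq_generateFrom_isClosed (α := Circle)) isPiSystem_isClosed with
  | empty => exact ⟨0, .zero _, by simp⟩
  | basic F hF =>
    have hF : IsClosed F := hF
    let δ : ℕ → ℝ := fun n => 1 / ((n : ℝ) + 1)
    have hδ : ∀ n, 0 < δ n := fun n => Nat.one_div_pos_of_nat
    have hδ0 : Tendsto δ atTop (𝓝 0) := tendsto_one_div_add_atTop_nhds_zero_nat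
    let φ : ℕ → C(Circle, ℝ) := fun n =>
      ⟨fun z => ((thickenedIndicator (hδ n) F z : NNReal) : ℝ), by fun_prop⟩
    have hφ1 : ∀ n z, z ∈ F → φ n z = 1 := fun n z hz => by
      exact congrArg NNReal.toReal (thickenedIndicator_one (hδ n) F hz)
    have hφle : ∀ n z, ‖φ n z‖ ≤ 1 := fun n z => by
      simpa [φ] using thickenedIndicator_le_one (hδ n) F z
    have hφnorm : ∀ n, ‖Φ (toComplexMap (φ n))‖ ≤ 1 := fun n => by
      refine (NonUnitalStarAlgHom.norm_apply_le Φ _).trans ?_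
      refine (ContinuousMap.norm_le _ zero_le_one).2 fun z => ?_
      simpa [toComplexMap] using hφle n z
    have hlim : ∀ x, Tendsto (fun n => ⟪x, Φ (toComplexMap (φ n)) x⟫) atTop
        (𝓝 ((μ x).real F : ℂ)) := by
      intro x
      simp_rw [hμ]
      exact (Complex.continuous_ofReal.tendsto _).comp
        (tendsto_integral_thickenedIndicator_of_isClosed (μ x) hF hδ hδ0)
    obtain ⟨P, hP⟩ := exists_weak_limit _ hφnorm _ hlim
    have hq : ∀ x, ⟪x, P x⟫ = ((μ x).real F : ℂ) := fun x => tendsto_nhds_unique (hP x x) (hlim x)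
    have hsa := isSelfAdjoint_of_inner_real _ hq
    refine ⟨P, ⟨?_, hsa⟩, hq⟩
    refine eq_of_inner_self_eq fun x => ?_
    have key : ∀ m, ⟪x, P (Φ (toComplexMap (φ m)) x)⟫ = ((μ x).real F : ℂ) := by
      intro m
      refine tendsto_nhds_unique (hP x _) ?_
      have h1 : ∀ n, ⟪x, Φ (toComplexMap (φ n)) (Φ (toComplexMap (φ m)) x)⟫
          = ((∫ z, φ n z * φ m z ∂(μ x) : ℝ) : ℂ) := by
        intro n
        have : toComplexMap (φ n * φ m) = toComplexMap (φ n) * toComplexMap (φ m) := by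
          ext z; simp [toComplexMap]
        have h2 := hμ x (φ n * φ m)
        rw [this, map_mul] at h2
        exact h2
      simp_rw [h1]
      refine (Complex.continuous_ofReal.tendsto _).comp ?_
      have h3 : (μ x).real F = ∫ z, F.indicator (fun _ => (1 : ℝ)) z ∂(μ x) := by
        rw [integral_indicator_const _ hF.measurableSet]; simp
      rw [h3]
      refine tendsto_integral_of_dominated_convergence (fun _ => 1) ?_ (integrable_const _) ?_ ?_
      · intro n
        exact (Continuous.mul (φ n).continuous (φ m).continuous).aestronglyMeasurable
      · intro n
        refine Eventually.of_forall fun z => ?_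
        rw [norm_mul]
        exact mul_le_one₀ (hφle n z) (norm_nonneg _) (hφle m z)
      · refine Eventually.of_forall fun z => ?_
        have h4 := thickenedIndicator_tendsto_indicator_closure hδ hδ0 F
        rw [hF.closure_eq, tendsto_pi_nhds] at h4
        have h5 := ((NNReal.continuous_coe.tendsto _).comp (h4 z)).mul_const (φ m z)
        have h6 : F.indicator (fun _ => (1 : ℝ)) z
            = ((F.indicator (fun _ => (1 : NNReal)) z : NNReal) : ℝ) * φ m z := by
          by_cases hz : z ∈ F
          · simp [hz, hφ1 m z hz]
          · simp [hz]
        rw [h6]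
        exact h5
    have hadj : ∀ y z, ⟪y, P z⟫ = ⟪P y, z⟫ := fun y z =>
      ((ContinuousLinearMap.isSelfAdjoint_iff_isSymmetric.1 hsa) y z).symm
    have h6 := hP (P x) x
    have h7 : Tendsto (fun n => ⟪P x, Φ (toComplexMap (φ n)) x⟫) atTop
        (𝓝 ((μ x).real F : ℂ)) := by
      simp_rw [← hadj, key]
      exact tendsto_const_nhds
    rw [hq, ← tendsto_nhds_unique h6 h7, ← hadj]
    rfl
  | compl S hS ih =>
    obtain ⟨P, hP, hq⟩ := ih
    refine ⟨1 - P, hP.one_sub, fun x => ?_⟩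
    rw [sub_apply, inner_sub_right, hq, one_apply_eq_self, huniv,
      measureReal_compl hS]
    simp
  | iUnion f hd hf ih =>
    choose P hP hq using ih
    have hadj : ∀ i y z, ⟪y, P i z⟫ = ⟪P i y, z⟫ := fun i y z =>
      ((ContinuousLinearMap.isSelfAdjoint_iff_isSymmetric.1 (hP i).isSelfAdjoint) y z).symm
    have hid : ∀ i y, P i (P i y) = P i y := fun i y =>
      congrArg (fun f : H →L[ℂ] H => f y) (hP i).isIdempotentElem
    have horth : ∀ i j, i ≠ j → P i * P j = 0 := by
      intro i j hij
      ext x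
      set y := P j x with hy
      have h1 : (μ y).real (f i) + (μ y).real (f j) ≤ (μ y).real Set.univ := by
        rw [← measureReal_union (hd hij) (hf j)]
        exact measureReal_mono (Set.subset_univ _)
      have h2 : (μ y).real (f j) = (μ y).real Set.univ := by
        have : ((μ y).real (f j) : ℂ) = ((μ y).real Set.univ : ℂ) := by
          rw [← hq, ← huniv, hy, hid]
        exact_mod_cast this
      have h3 : (μ y).real (f i) = 0 := by
        have := measureReal_nonneg (μ := μ y) (s := f i)
        linarith
      have h4 : ⟪P i y, P i y⟫ = 0 := by
        rw [norm_sq_projection (hP i), hq, h3]; simp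
      simpa using h4
    let Q : ℕ → H →L[ℂ] H := fun n => ∑ i ∈ Finset.range n, P i
    have hQ : ∀ n, IsStarProjection (Q n) := by
      intro n
      induction n with
      | zero => simp [Q]
      | succ n ih =>
        have : Q (n + 1) = Q n + P n := Finset.sum_range_succ _ _
        rw [this]
        refine ih.add (hP n) ?_
        rw [Finset.sum_mul]
        exact Finset.sum_eq_zero fun i hi => horth i n (Finset.mem_range.1 hi).ne
    have hsum : ∀ x, HasSum (fun i => ((μ x).real (f i) : ℂ)) ((μ x).real (⋃ i, f i) : ℂ) := by
      intro x
      have h : HasSum (fun i => (μ x).real (f i)) ((μ x).real (⋃ i, f i)) := by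
        have hs : ∑' i, μ x (f i) ≠ ⊤ := by
          rw [← measure_iUnion hd hf]; exact measure_ne_top _ _
        have h := ENNReal.hasSum_toReal hs
        rwa [← ENNReal.tsum_toReal_eq (fun i => measure_ne_top _ _), ← measure_iUnion hd hf] at h
      exact_mod_cast h
    have hlim : ∀ x, Tendsto (fun n => ⟪x, Q n x⟫) atTop (𝓝 ((μ x).real (⋃ i, f i) : ℂ)) := by
      intro x
      refine (hsum x).tendsto_sum_nat.congr fun n => ?_
      simp only [Q, sum_apply, inner_sum, hq]
    obtain ⟨A, hA⟩ := exists_weak_limit Q (fun n => (hQ n).norm_le) _ hlim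
    have hqA : ∀ x, ⟪x, A x⟫ = ((μ x).real (⋃ i, f i) : ℂ) :=
      fun x => tendsto_nhds_unique (hA x x) (hlim x)
    have hsa := isSelfAdjoint_of_inner_real _ hqA
    have hadjA : ∀ y z, ⟪y, A z⟫ = ⟪A y, z⟫ := fun y z =>
      ((ContinuousLinearMap.isSelfAdjoint_iff_isSymmetric.1 hsa) y z).symm
    have hPA : ∀ i x y, ⟪P i x, A y⟫ = ⟪P i x, y⟫ := by
      intro i x y
      refine tendsto_nhds_unique (hA (P i x) y) ?_
      refine tendsto_const_nhds.congr' ?_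
      filter_upwards [eventually_gt_atTop i] with n hn
      have : P i * Q n = P i := by
        rw [Finset.mul_sum, Finset.sum_eq_single i]
        · exact (hP i).isIdempotentElem
        · intro j _ hj
          exact horth i j hj.symm
        · intro h
          exact absurd (Finset.mem_range.2 hn) h
      have h2 := congrArg (fun f : H →L[ℂ] H => f y) this
      simp only [mul_apply_eq_comp] at h2
      rw [← hadj, ← hadj, h2]
    refine ⟨A, ⟨?_, hsa⟩, hqA⟩
    refine eq_of_inner_self_eq fun x => ?_
    rw [mul_apply_eq_comp, hadjA]
    -- pass to the limit in `⟪Q n x, A x⟫ = ⟪Q n x, x⟫`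
    have h1 : Tendsto (fun n => ⟪A x, Q n x⟫) atTop (𝓝 ⟪A x, A x⟫) := hA _ _
    have h2 : Tendsto (fun n => ⟪x, Q n x⟫) atTop (𝓝 ⟪x, A x⟫) := hA _ _
    refine tendsto_nhds_unique h1 (h2.congr fun n => ?_)
    simp only [Q, sum_apply, inner_sum]
    refine Finset.sum_congr rfl fun i _ => ?_
    rw [← inner_conj_symm, ← inner_conj_symm (A x), hPA]


theorem hasSum_inner_of_diag (T : ℕ → H →L[ℂ] H) (A : H →L[ℂ] H)
    (h : ∀ x, HasSum (fun n => ⟪x, T n x⟫) ⟪x, A x⟫) (x y : H) :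
    HasSum (fun n => ⟪x, T n y⟫) ⟪x, A y⟫ := by
  have h' : ∀ x, HasSum (fun n => ⟪T n x, x⟫) ⟪A x, x⟫ := by
    intro x
    have := Complex.conjCLE.toContinuousLinearMap.hasSum (h x)
    simpa using this
  have h2 := ((((h' (y + x)).sub (h' (y - x))).sub ((h' (y + Complex.I • x)).mul_left
      Complex.I)).add ((h' (y - Complex.I • x)).mul_left Complex.I)).div_const 4
  have h3 : HasSum (fun n => ⟪T n y, x⟫) ⟪A y, x⟫ := by
    have e1 := inner_map_polarization' (A : H →ₗ[ℂ] H) y x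
    simp only [ContinuousLinearMap.coe_coe] at e1
    rw [e1]
    refine h2.congr_fun fun n => ?_
    exact inner_map_polarization' (T n : H →ₗ[ℂ] H) y x
  have := Complex.conjCLE.toContinuousLinearMap.hasSum h3
  simpa using this

/-- The spectral theorem for unitary operators. -/
theorem exists_projectionValued_represents (U : H ≃ₗᵢ[ℂ] H) :
    ∃ E : OperatorMeasure H, E.IsProjectionValued ∧ E.Represents (U : H →L[ℂ] H) := by
  classical
  obtain ⟨Φ, hΦ⟩ := exists_circle_calculus U
  choose μ hfin hμ using exists_scalar_measure Φ
  choose! P hP hq using exists_projection Φ μ hμ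
  have huniv : ∀ x, ⟪x, x⟫ = ((μ x).real Set.univ : ℂ) := by
    intro x
    have h1 : toComplexMap 1 = 1 := by ext z; simp [toComplexMap]
    have := hμ x 1
    simpa [h1] using this
  let E : OperatorMeasure H :=
    { toFun := P
      isPositive := fun S hS => by
        rw [ContinuousLinearMap.isPositive_iff_complex]
        intro x
        have : ⟪P S x, x⟫ = ((μ x).real S : ℂ) := by
          rw [← inner_conj_symm, hq S hS]; simp
        rw [this]
        simp
      map_univ := eq_of_inner_self_eq fun x => by
        rw [hq _ .univ, one_apply_eq_self, huniv]
      hasSum_iUnion := fun S hS hd => hasSum_inner_of_diag _ _ fun x => by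
        rw [hq _ (.iUnion hS)]
        simp_rw [fun i => hq (S i) (hS i) x]
        have h : HasSum (fun i => (μ x).real (S i)) ((μ x).real (⋃ i, S i)) := by
          have hs : ∑' i, μ x (S i) ≠ ⊤ := by
            rw [← measure_iUnion hd hS]; exact measure_ne_top _ _
          have h := ENNReal.hasSum_toReal hs
          rwa [← ENNReal.tsum_toReal_eq (fun i => measure_ne_top _ _),
            ← measure_iUnion hd hS] at h
        exact_mod_cast h }
  have hE : ∀ x, E.scalar x = μ x := by
    intro x
    refine Measure.ext fun S hS => ?_
    rw [OperatorMeasure.scalar, Measure.ofMeasurable_apply _ hS]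
    change ENNReal.ofReal (⟪x, P S x⟫).re = _
    rw [hq S hS, Complex.ofReal_re, ofReal_measureReal]
  refine ⟨E, hP, fun x => ?_⟩
  rw [hE, ← hΦ]
  let fr : C(Circle, ℝ) := ⟨fun z => (z : ℂ).re, by fun_prop⟩
  let fi : C(Circle, ℝ) := ⟨fun z => (z : ℂ).im, by fun_prop⟩
  have hid : (⟨fun z => (z : ℂ), by fun_prop⟩ : C(Circle, ℂ))
      = toComplexMap fr + Complex.I • toComplexMap fi := by
    ext z
    simp only [toComplexMap, fr, fi, ContinuousMap.add_apply, ContinuousMap.smul_apply,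
      ContinuousMap.coe_mk, smul_eq_mul, mul_comm Complex.I]
    exact (Complex.re_add_im _).symm
  have hint : Integrable (fun z : Circle => (z : ℂ)) (μ x) :=
    Integrable.of_bound (by fun_prop) 1 (Eventually.of_forall fun z => (Circle.norm_coe z).le)
  rw [hid, map_add, map_smul, add_apply, smul_apply, inner_add_right, inner_smul_right, hμ, hμ,
    ← integral_re_add_im hint]
  simp [fr, fi, mul_comm Complex.I]

/-- Every isometry of a Hilbert space has a unitary extension. -/
theorem exists_unitary_extension (K : H →ₗᵢ[ℂ] H) :
    ∃ (H' : Type u) (_ : NormedAddCommGroup H') (_ : InnerProductSpace ℂ H')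
      (_ : CompleteSpace H') (ι : H →ₗᵢ[ℂ] H') (K' : H' ≃ₗᵢ[ℂ] H'),
      ∀ f, K' (ι f) = ι (K f) := by
  let D : Submodule ℂ H := (LinearMap.range K.toLinearMap)ᗮ
  let ℓ := lp (fun _ : ℕ => D) 2
  have h2 : (0 : ℝ) < (2 : ENNReal).toReal := by norm_num
  have hsq : ∀ d : ℓ, HasSum (fun n => ‖d n‖ ^ 2) (‖d‖ ^ 2) := fun d => by
    simpa using lp.hasSum_norm h2 d
  have hmem : ∀ d : ℕ → D, Summable (fun n => ‖d n‖ ^ 2) → Memℓp d 2 := fun d hd => by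
    refine (memℓp_gen_iff h2).2 ?_
    simpa using hd
  let shift : ℓ → ℓ := fun d => ⟨fun n => d (n + 1),
    hmem _ ((summable_nat_add_iff 1).2 (hsq d).summable)⟩
  have hshift : ∀ d : ℓ, ‖d‖ ^ 2 = ‖d 0‖ ^ 2 + ‖shift d‖ ^ 2 := fun d => by
    rw [← (hsq d).tsum_eq, ← (hsq (shift d)).tsum_eq, (hsq d).summable.tsum_eq_zero_add]
  let T : WithLp 2 (H × ℓ) →ₗ[ℂ] WithLp 2 (H × ℓ) :=
    { toFun := fun p => WithLp.toLp 2 (K p.fst + (p.snd 0 : H), shift p.snd)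
      map_add' := fun p q => by
        refine WithLp.ofLp_injective 2 (Prod.ext ?_ ?_)
        · simp; abel
        · rfl
      map_smul' := fun c p => by
        refine WithLp.ofLp_injective 2 (Prod.ext ?_ ?_)
        · simp
          rfl
        · rfl }
  have horth : ∀ (h : H) (d : D), ⟪K h, (d : H)⟫ = 0 := fun h d =>
    (Submodule.mem_orthogonal _ _).1 d.2 (K h) ⟨h, rfl⟩
  have hT : ∀ p, ‖T p‖ = ‖p‖ := fun p => by
    rw [← sq_eq_sq₀ (norm_nonneg _) (norm_nonneg _), WithLp.prod_norm_sq_eq_of_L2,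
      WithLp.prod_norm_sq_eq_of_L2]
    have e1 : ‖K p.fst + (p.snd 0 : H)‖ ^ 2 = ‖p.fst‖ ^ 2 + ‖p.snd 0‖ ^ 2 := by
      have := norm_add_sq_eq_norm_sq_add_norm_sq_of_inner_eq_zero _ _ (horth p.fst (p.snd 0))
      simpa [sq] using this
    have e2 := hshift p.snd
    change ‖K p.fst + (p.snd 0 : H)‖ ^ 2 + ‖shift p.snd‖ ^ 2 = _
    linarith
  let Ti : WithLp 2 (H × ℓ) →ₗᵢ[ℂ] WithLp 2 (H × ℓ) := ⟨T, hT⟩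
  have hsurj : Function.Surjective Ti := by
    intro q
    have hc : IsClosed ((LinearMap.range K.toLinearMap : Submodule ℂ H) : Set H) := by
      have hr : ((LinearMap.range K.toLinearMap : Submodule ℂ H) : Set H) = Set.range K := rfl
      rw [hr]
      exact K.isometry.isClosedEmbedding.isClosed_range
    have : CompleteSpace (LinearMap.range K.toLinearMap) := hc.completeSpace_coe
    obtain ⟨y, ⟨h, rfl⟩, z, hz, hyz⟩ :=
      (LinearMap.range K.toLinearMap).exists_add_mem_mem_orthogonal q.fst
    let d : ℕ → D := fun n => Nat.casesOn n ⟨z, hz⟩ (fun k => q.snd k)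
    have hd : Memℓp d 2 := hmem _ ((summable_nat_add_iff 1).1 (hsq q.snd).summable)
    refine ⟨WithLp.toLp 2 (h, (⟨d, hd⟩ : ℓ)), ?_⟩
    refine WithLp.ofLp_injective 2 (Prod.ext ?_ ?_)
    · exact hyz.symm
    · rfl
  let ι₀ : H →ₗ[ℂ] WithLp 2 (H × ℓ) :=
    { toFun := fun h => WithLp.toLp 2 (h, 0)
      map_add' := fun a b => by
        refine WithLp.ofLp_injective 2 (Prod.ext ?_ ?_) <;> simp
      map_smul' := fun c a => by
        refine WithLp.ofLp_injective 2 (Prod.ext ?_ ?_) <;> simp }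
  refine ⟨WithLp 2 (H × ℓ), inferInstance, inferInstance, inferInstance,
    ⟨ι₀, fun h => ?_⟩, LinearIsometryEquiv.ofSurjective Ti hsurj, fun f => ?_⟩
  · rw [← sq_eq_sq₀ (norm_nonneg _) (norm_nonneg _), WithLp.prod_norm_sq_eq_of_L2]
    simp [ι₀]
  · refine WithLp.ofLp_injective 2 (Prod.ext ?_ ?_)
    · simp [Ti, T, ι₀]
    · rfl

end Existence

section SpectralMeasure

variable {H : Type u} [NormedAddCommGroup H] [InnerProductSpace ℂ H] [CompleteSpace H]

/-- `E` is a spectral measure of the isometry `K`: there is a unitary extension `K'` of `K` on a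
Hilbert space `H' ⊇ H`, with projection-valued spectral measure `E'`, such that `E` is the
compression of `E'` to `H`. -/
def IsSpectralMeasure (K : H →ₗᵢ[ℂ] H) (E : OperatorMeasure H) : Prop :=
  ∃ (H' : Type u) (_ : NormedAddCommGroup H') (_ : InnerProductSpace ℂ H')
    (_ : CompleteSpace H') (ι : H →ₗᵢ[ℂ] H') (K' : H' ≃ₗᵢ[ℂ] H') (E' : OperatorMeasure H'),
    (∀ f, K' (ι f) = ι (K f)) ∧ E'.IsProjectionValued ∧ E'.Represents (K' : H' →L[ℂ] H') ∧
      E = E'.compress ι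

theorem exists_isSpectralMeasure (K : H →ₗᵢ[ℂ] H) : ∃ E, IsSpectralMeasure K E := by
  obtain ⟨H', i1, i2, i3, ι, K', hK⟩ := exists_unitary_extension K
  obtain ⟨E', h1, h2⟩ := exists_projectionValued_represents K'
  exact ⟨E'.compress ι, H', i1, i2, i3, ι, K', E', hK, h1, h2, rfl⟩

/-- The spectral measure `ℰ` of the isometry `K`. -/
def spectralMeasure (K : H →ₗᵢ[ℂ] H) : OperatorMeasure H :=
  (exists_isSpectralMeasure K).choose

/-- The scalar spectral measure `μ_g(S) = ⟨ℰ(S) g, g⟩`. -/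
def scalarSpectralMeasure (K : H →ₗᵢ[ℂ] H) (g : H) : Measure Circle :=
  (spectralMeasure K).scalar g

end SpectralMeasure

/-- The Koopman operator `g ↦ g ∘ F` on `L²(Ω, ω)` of a measure-preserving map `F`. -/
def koopman {Ω : Type u} [MeasurableSpace Ω] {ω : Measure Ω} {F : Ω → Ω}
    (hF : MeasurePreserving F ω ω) : Lp ℂ 2 ω →ₗᵢ[ℂ] Lp ℂ 2 ω :=
  Lp.compMeasurePreservingₗᵢ ℂ F hF

/-- The Wasserstein-1 distance, as the supremum over real 1-Lipschitz functions on `𝕋`. -/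
def W1 (μ ν : Measure Circle) : EReal :=
  ⨆ (φ : Circle → ℝ) (_ : LipschitzWith 1 φ), ((∫ z, φ z ∂μ - ∫ z, φ z ∂ν : ℝ) : EReal)

section Matrices

variable {Ω : Type u} {N M : ℕ}

/-- The `M × N` matrix with rows `Ψ(x⁽ᵐ⁾) = (ψ₁(x⁽ᵐ⁾), …, ψ_N(x⁽ᵐ⁾))`. -/
def dictMatrix (ψ : Fin N → Ω → ℂ) (x : Fin M → Ω) : Matrix (Fin M) (Fin N) ℂ :=
  Matrix.of fun m j => ψ j (x m)

/-- `W = diag(w₁, …, w_M)`. -/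
def weightMatrix (w : Fin M → ℝ) : Matrix (Fin M) (Fin M) ℂ :=
  Matrix.diagonal fun m => (w m : ℂ)

/-- `G = Ψ_X* W Ψ_X`. -/
def gramMatrix (ψ : Fin N → Ω → ℂ) (x : Fin M → Ω) (w : Fin M → ℝ) :
    Matrix (Fin N) (Fin N) ℂ :=
  (dictMatrix ψ x).conjTranspose * weightMatrix w * dictMatrix ψ x

/-- `A = Ψ_X* W Ψ_Y`. -/
def crossMatrix (ψ : Fin N → Ω → ℂ) (x y : Fin M → Ω) (w : Fin M → ℝ) :
    Matrix (Fin N) (Fin N) ℂ :=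
  (dictMatrix ψ x).conjTranspose * weightMatrix w * dictMatrix ψ y

open scoped MatrixOrder in
/-- `(𝕂, V, λ)` is an output of the mpEDMD algorithm with input matrices `G` and `A`:
for some singular value decomposition `G^{-1/2} A* G^{-1/2} = U₁ Σ U₂*` and some unitary
eigendecomposition `U₂ U₁* = V̂ Λ V̂*`, one has `𝕂 = G^{-1/2} U₂ U₁* G^{1/2}` and
`V = G^{-1/2} V̂`. The columns of `V` are the eigenvectors `v_j`. -/
def IsMpEDMDOutput (G A 𝕂 V : Matrix (Fin N) (Fin N) ℂ) (lam : Fin N → ℂ) : Prop :=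
  ∃ (U₁ U₂ Vhat : Matrix (Fin N) (Fin N) ℂ) (σ : Fin N → ℝ),
    U₁ ∈ Matrix.unitaryGroup (Fin N) ℂ ∧ U₂ ∈ Matrix.unitaryGroup (Fin N) ℂ ∧
    Vhat ∈ Matrix.unitaryGroup (Fin N) ℂ ∧ (∀ i, 0 ≤ σ i) ∧
    (CFC.sqrt G)⁻¹ * A.conjTranspose * (CFC.sqrt G)⁻¹ =
      U₁ * Matrix.diagonal (fun i => (σ i : ℂ)) * U₂.conjTranspose ∧
    U₂ * U₁.conjTranspose = Vhat * Matrix.diagonal lam * Vhat.conjTranspose ∧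
    𝕂 = (CFC.sqrt G)⁻¹ * (U₂ * U₁.conjTranspose) * CFC.sqrt G ∧
    V = (CFC.sqrt G)⁻¹ * Vhat

/-- `μ_𝐠^{(N,M)} = ∑_j |v_j* G 𝐠|² δ_{λ_j}`, restricted to the Borel subsets of `𝕋 ⊆ ℂ`. -/
def mpEDMDMeasure (G V : Matrix (Fin N) (Fin N) ℂ) (lam : Fin N → ℂ) (gv : Fin N → ℂ) :
    Measure Circle :=
  Measure.comap ((↑) : Circle → ℂ) (∑ j, ENNReal.ofReal
    (‖star (fun i => V i j) ⬝ᵥ G.mulVec gv‖ ^ 2) • Measure.dirac (lam j))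

end Matrices

end MpEDMD

end

open MpEDMD

noncomputable section

open Filter Topology

open scoped ComplexInnerProductSpace

namespace MpEDMD

universe u

/-! ### Lipschitz functions and trigonometric polynomials on the circle. -/

section TrigonometricApproximation

/-! Both measures are probability measures on the circle, and their moments are exactly the two
quantities compared on the right-hand side. The theorem is therefore a quantitative statement about
measures with close moments (`integral_sub_integral_le`), combined with two moment computations.

For the quantitative statement, a 1-Lipschitz `φ` is convolved with a nonnegative kernel `k = |∑ b_i
u^i|²` of degree at most `L`. With sine coefficients (the Fejér–Korovkin choice), `k` has mass one
and `∫ |1 - u|² k ≤ (π / (L + 2))²`, so the convolution `σ` is uniformly within `π / (L + 2)` of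
`φ`. Since `σ` is a trigonometric polynomial of degree at most `L`, its integral against `μ - ν`
sees only the moments up to order `L`. The Fourier coefficients of `φ` are `O(1/n)` by
`norm_fourierCoeff_le`, and `sum_toeplitz_le` bounds the effect of the kernel's coefficients
independently of `L`, which yields the weights `1/l`. The resulting error `O(1/L)` is stronger than
`log L / L`.

The moments of `μ_g` are computed in the unitary extension, where disjoint sets have orthogonal
spectral projections, so that integration against `E'` respects powers
(`integral_pow_scalarSpectralMeasure`). The moments of the mpEDMD measure come from diagonalizing
`𝕂`, which conjugation by `G^{1/2}` makes unitary (`mpEDMD_moments`). -/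

theorem exists_isMulLeftInvariant_isProbabilityMeasure :
    ∃ h : Measure Circle, h.IsMulLeftInvariant ∧ IsProbabilityMeasure h :=
  ⟨Measure.haarMeasure ⊤, inferInstance, ⟨by
    simpa using Measure.haarMeasure_self (K₀ := (⊤ : TopologicalSpace.PositiveCompacts Circle))⟩⟩

theorem integrable_of_continuous_circle {E : Type*} [NormedAddCommGroup E]
    {f : Circle → E} (hf : Continuous f)
    (μ : Measure Circle) [IsFiniteMeasure μ] : Integrable f μ :=
  hf.integrable_of_hasCompactSupport (HasCompactSupport.of_compactSpace f)

theorem continuous_circle_zpow (n : ℤ) : Continuous fun z : Circle => ((z ^ n : Circle) : ℂ) :=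
  (show Continuous fun z : Circle => (z : ℂ) by fun_prop).comp (continuous_zpow n)

theorem circle_dist_eq_norm (z w : Circle) : dist z w = ‖(z : ℂ) - w‖ := by
  rw [← dist_eq_norm]
  rfl

theorem integral_conj_zpow (μ : Measure Circle) (n : ℤ) :
    ∫ z, ((z ^ (-n) : Circle) : ℂ) ∂μ = starRingEnd ℂ (∫ z, ((z ^ n : Circle) : ℂ) ∂μ) := by
  rw [← integral_conj]
  simp only [zpow_neg, Circle.coe_inv_eq_conj]

/-- The Fourier coefficients of a Lipschitz function decay like `1 / n`. -/
theorem norm_fourierCoeff_le (h : Measure Circle) [h.IsMulLeftInvariant] [IsProbabilityMeasure h]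
    {φ : Circle → ℝ} (hφ : LipschitzWith 1 φ) {n : ℤ} (hn : n ≠ 0) :
    ‖∫ w, (φ w : ℂ) * ((w ^ n : Circle) : ℂ) ∂h‖ ≤ Real.pi / (2 * n.natAbs) := by
  have hc := hφ.continuous
  -- Translation by `ζ` changes the sign of `w ^ n`, so twice the coefficient is the integral of `(φ
  -- w - φ (ζ w)) w ^ n`, and `|ζ - 1| ≤ π / |n|`.
  set ζ : Circle := Circle.exp (Real.pi / n) with hζ
  have hn' : (n : ℝ) ≠ 0 := by exact_mod_cast hn
  have hζn : ((ζ ^ n : Circle) : ℂ) = -1 := by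
    have : ζ ^ n = Circle.exp Real.pi := by
      rw [hζ, ← Circle.exp_zsmul]
      congr 1
      simp
      field_simp
    rw [this]
    simp
  have hdist : ∀ w : Circle, ‖(φ w : ℂ) - φ (ζ * w)‖ ≤ Real.pi / n.natAbs := by
    intro w
    have h1 := hφ.dist_le_mul w (ζ * w)
    rw [Real.dist_eq] at h1
    have h2 : ‖(φ w : ℂ) - φ (ζ * w)‖ = |φ w - φ (ζ * w)| := by
      rw [← Complex.ofReal_sub, Complex.norm_real, Real.norm_eq_abs]
    rw [h2]
    refine h1.trans ?_
    have h3 : dist w (ζ * w) = ‖(ζ : ℂ) - 1‖ := by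
      rw [dist_comm]
      have : ((ζ * w : Circle) : ℂ) - (w : ℂ) = ((ζ : ℂ) - 1) * w := by push_cast; ring
      rw [circle_dist_eq_norm, this, norm_mul, Circle.norm_coe, mul_one]
    rw [h3, NNReal.coe_one, one_mul, hζ, Circle.coe_exp, mul_comm]
    refine (Real.norm_exp_I_mul_ofReal_sub_one_le).trans ?_
    rw [Real.norm_eq_abs, abs_div, abs_of_pos Real.pi_pos, Nat.cast_natAbs, Int.cast_abs]
  have key : ∫ w, (φ w : ℂ) * ((w ^ n : Circle) : ℂ) ∂h
      = - ∫ w, (φ (ζ * w) : ℂ) * ((w ^ n : Circle) : ℂ) ∂h := by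
    rw [← integral_mul_left_eq_self (μ := h) (fun w => (φ w : ℂ) * ((w ^ n : Circle) : ℂ)) ζ,
      ← integral_neg]
    refine integral_congr_ae (Eventually.of_forall fun w => ?_)
    simp only [mul_zpow, Circle.coe_mul, hζn]
    ring
  have h2 : 2 * ∫ w, (φ w : ℂ) * ((w ^ n : Circle) : ℂ) ∂h
      = ∫ w, ((φ w : ℂ) - φ (ζ * w)) * ((w ^ n : Circle) : ℂ) ∂h := by
    rw [two_mul]
    nth_rw 2 [key]
    rw [← sub_eq_add_neg, ← integral_sub]
    · simp only [sub_mul]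
    all_goals
      exact integrable_of_continuous_circle (Continuous.mul (by fun_prop) (continuous_circle_zpow _)) _
  have h3 : ‖2 * ∫ w, (φ w : ℂ) * ((w ^ n : Circle) : ℂ) ∂h‖ ≤ Real.pi / n.natAbs := by
    rw [h2]
    refine (norm_integral_le_of_norm_le_const (C := Real.pi / n.natAbs)
      (Eventually.of_forall fun w => ?_)).trans (by simp)
    rw [norm_mul, Circle.norm_coe, mul_one]
    exact hdist w
  rw [norm_mul, Complex.norm_ofNat] at h3
  rw [mul_comm 2, ← div_div]
  linarith

/-- Translation by `exp (iπ / n)` multiplies the integrand by `-1`, so the integral equals its own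
negative. -/
theorem integral_zpow_eq_zero (h : Measure Circle) [h.IsMulLeftInvariant] {n : ℤ} (hn : n ≠ 0) :
    ∫ w, ((w ^ n : Circle) : ℂ) ∂h = 0 := by
  have hn' : (n : ℝ) ≠ 0 := by exact_mod_cast hn
  have hζn : (Circle.exp (Real.pi / n)) ^ n = Circle.exp Real.pi := by
    rw [← Circle.exp_zsmul]
    congr 1
    simp
    field_simp
  have := integral_mul_left_eq_self (μ := h) (fun w => ((w ^ n : Circle) : ℂ))
    (Circle.exp (Real.pi / n))
  simp only [mul_zpow, hζn, Circle.coe_mul, integral_const_mul] at this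
  simp at this
  exact self_eq_neg.1 this.symm

theorem norm_sq_sum_eq (a : ℕ → ℝ) (n : ℕ) (u : Circle) :
    ((‖∑ i ∈ Finset.range n, (a i : ℂ) * (u : ℂ) ^ i‖ ^ 2 : ℝ) : ℂ)
      = ∑ i ∈ Finset.range n, ∑ j ∈ Finset.range n,
        (a i * a j : ℂ) * ((u ^ ((i : ℤ) - j) : Circle) : ℂ) := by
  rw [Complex.ofReal_pow, ← Complex.mul_conj', map_sum, Finset.sum_mul_sum]
  refine Finset.sum_congr rfl fun i _ => Finset.sum_congr rfl fun j _ => ?_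
  rw [zpow_sub, zpow_natCast, zpow_natCast]
  simp only [Circle.coe_mul, Circle.coe_inv_eq_conj, Circle.coe_pow, map_mul, map_pow,
    Complex.conj_ofReal]
  ring

/-- Parseval's identity for polynomials on the circle. -/
theorem integral_norm_sq_sum (h : Measure Circle) [h.IsMulLeftInvariant] [IsProbabilityMeasure h]
    (a : ℕ → ℝ) (n : ℕ) :
    ∫ u : Circle, ‖∑ i ∈ Finset.range n, (a i : ℂ) * (u : ℂ) ^ i‖ ^ 2 ∂h
      = ∑ i ∈ Finset.range n, a i ^ 2 := by
  have hint : ∀ i j : ℕ, Integrable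
      (fun u : Circle => (a i * a j : ℂ) * ((u ^ ((i : ℤ) - j) : Circle) : ℂ)) h :=
    fun i j => integrable_of_continuous_circle
      (continuous_const.mul (continuous_circle_zpow _)) _
  apply Complex.ofReal_injective
  rw [← integral_complex_ofReal]
  simp_rw [norm_sq_sum_eq]
  rw [integral_finsetSum _ fun i _ => integrable_finsetSum _ fun j _ => hint i j]
  simp_rw [fun i => integral_finsetSum (Finset.range n) fun j _ => hint i j, integral_const_mul]
  rw [Complex.ofReal_sum]
  refine Finset.sum_congr rfl fun i hi => ?_
  rw [Finset.sum_eq_single i]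
  · simp [sq]
  · intro j _ hj
    rw [integral_zpow_eq_zero h (by omega), mul_zero]
  · exact fun h => absurd hi h

/-- The sequence `m ↦ sin (θ m)` with `θ = π / (L + 2)` vanishes at `0` and `L + 2`. It is the
lowest eigenvector of the discrete Dirichlet Laplacian on the `L + 1` points between, with
eigenvalue `2 (1 - cos θ)`; its energy is that eigenvalue times its squared norm. -/
theorem sum_sin_sq_shift (L : ℕ) :
    ∑ m ∈ Finset.range (L + 2), (Real.sin (Real.pi / (L + 2) * ((m + 1 : ℕ) : ℝ))
        - Real.sin (Real.pi / (L + 2) * (m : ℝ))) ^ 2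
      = 2 * (1 - Real.cos (Real.pi / (L + 2))) *
        ∑ m ∈ Finset.range (L + 1), Real.sin (Real.pi / (L + 2) * ((m + 1 : ℕ) : ℝ)) ^ 2 := by
  set θ := Real.pi / (L + 2) with hθ
  set s : ℕ → ℝ := fun m => Real.sin (θ * m) with hs
  have hs0 : s 0 = 0 := by simp [hs]
  have hsL : s (L + 2) = 0 := by
    have : θ * ((L + 2 : ℕ) : ℝ) = Real.pi := by
      rw [hθ]; push_cast; field_simp
    simp only [hs, this, Real.sin_pi]
  have hrec : ∀ m, s m + s (m + 2) = 2 * Real.cos θ * s (m + 1) := by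
    intro m
    simp only [hs]
    push_cast
    have h1 : θ * m = θ * (m + 1) - θ := by ring
    have h2 : θ * (m + 2) = θ * (m + 1) + θ := by ring
    rw [h1, h2, Real.sin_sub, Real.sin_add]
    ring
  change ∑ m ∈ Finset.range (L + 2), (s (m + 1) - s m) ^ 2
    = 2 * (1 - Real.cos θ) * ∑ m ∈ Finset.range (L + 1), s (m + 1) ^ 2
  have hA : ∑ m ∈ Finset.range (L + 2), s (m + 1) ^ 2
      = ∑ m ∈ Finset.range (L + 1), s (m + 1) ^ 2 := by
    rw [Finset.sum_range_succ, hsL]; simp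
  have hB : ∑ m ∈ Finset.range (L + 2), s m ^ 2
      = ∑ m ∈ Finset.range (L + 1), s (m + 1) ^ 2 := by
    rw [Finset.sum_range_succ', hs0]; simp
  have hC : ∑ m ∈ Finset.range (L + 2), s (m + 1) * s m
      = ∑ m ∈ Finset.range (L + 1), s (m + 1) * s m := by
    rw [Finset.sum_range_succ, hsL]; simp
  have hD : ∑ m ∈ Finset.range (L + 2), s (m + 1) * s m
      = ∑ m ∈ Finset.range (L + 1), s (m + 1) * s (m + 2) := by
    rw [Finset.sum_range_succ', hs0, mul_zero, add_zero]
    exact Finset.sum_congr rfl fun m _ => mul_comm _ _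
  -- The two copies of the cross sum are indexed differently, so that `s (m + 1)` meets both its
  -- neighbours and `hrec` applies.
  have hE : 2 * ∑ m ∈ Finset.range (L + 2), s (m + 1) * s m
      = 2 * Real.cos θ * ∑ m ∈ Finset.range (L + 1), s (m + 1) ^ 2 := by
    rw [two_mul]
    nth_rw 1 [hC]
    rw [hD, ← Finset.sum_add_distrib, Finset.mul_sum]
    refine Finset.sum_congr rfl fun m _ => ?_
    rw [← mul_add, hrec]
    ring
  have : ∀ m, (s (m + 1) - s m) ^ 2 = s (m + 1) ^ 2 + s m ^ 2 - 2 * (s (m + 1) * s m) := by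
    intro m; ring
  simp_rw [this]
  rw [Finset.sum_sub_distrib, Finset.sum_add_distrib, ← Finset.mul_sum, hE, hA, hB]
  ring

/-- A nonnegative trigonometric polynomial of degree at most `L`, of unit mass, concentrated
within distance `π / (L + 2)` of the point `1` in mean square. -/
theorem exists_concentrated_coeffs (L : ℕ) (h : Measure Circle) [h.IsMulLeftInvariant]
    [IsProbabilityMeasure h] :
    ∃ b : ℕ → ℝ, ∑ i ∈ Finset.range (L + 1), b i ^ 2 = 1 ∧
      ∫ u : Circle, ‖1 - (u : ℂ)‖ ^ 2 * ‖∑ i ∈ Finset.range (L + 1), (b i : ℂ) * (u : ℂ) ^ i‖ ^ 2 ∂h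
        ≤ (Real.pi / (L + 2)) ^ 2 := by
  set θ := Real.pi / (L + 2) with hθ
  set s : ℕ → ℝ := fun m => Real.sin (θ * m) with hs
  have hs0 : s 0 = 0 := by simp [hs]
  have hsL : s (L + 2) = 0 := by
    have : θ * ((L + 2 : ℕ) : ℝ) = Real.pi := by
      rw [hθ]; push_cast; field_simp
    simp only [hs, this, Real.sin_pi]
  set S := ∑ m ∈ Finset.range (L + 1), s (m + 1) ^ 2 with hS
  have hSpos : 0 < S := by
    have h1 : 0 < s 1 := by
      have : 0 < θ := by positivity
      refine Real.sin_pos_of_pos_of_lt_pi (by simpa using this) ?_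
      rw [hθ, Nat.cast_one, mul_one]
      exact div_lt_self Real.pi_pos (by linarith [(Nat.cast_nonneg L : (0 : ℝ) ≤ L)])
    refine lt_of_lt_of_le (pow_pos h1 2) ?_
    exact Finset.single_le_sum (f := fun m => s (m + 1) ^ 2) (fun _ _ => sq_nonneg _)
      (Finset.mem_range.2 (Nat.succ_pos L))
  have hr : (Real.sqrt S) ^ 2 = S := Real.sq_sqrt hSpos.le
  -- The normalized Dirichlet eigenvector. Multiplying the polynomial by `1 - u` replaces its
  -- coefficients by successive differences, the zeros `hs0` and `hsL` absorbing the end terms. By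
  -- Parseval the second moment is then `2 (1 - cos θ) ≤ θ²`.
  refine ⟨fun i => s (i + 1) / Real.sqrt S, ?_, ?_⟩
  · simp_rw [div_pow, hr]
    rw [← Finset.sum_div, ← hS, div_self hSpos.ne']
  · have e : ∀ u : Circle, ‖1 - (u : ℂ)‖ ^ 2 * ‖∑ i ∈ Finset.range (L + 1),
        ((s (i + 1) / Real.sqrt S : ℝ) : ℂ) * (u : ℂ) ^ i‖ ^ 2
        = ‖∑ i ∈ Finset.range (L + 2), (((s (i + 1) - s i) / Real.sqrt S : ℝ) : ℂ)
          * (u : ℂ) ^ i‖ ^ 2 := by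
      intro u
      rw [← mul_pow, ← norm_mul]
      congr 2
      have h1 : ∑ i ∈ Finset.range (L + 2), ((s (i + 1) / Real.sqrt S : ℝ) : ℂ) * (u : ℂ) ^ i
          = ∑ i ∈ Finset.range (L + 1), ((s (i + 1) / Real.sqrt S : ℝ) : ℂ) * (u : ℂ) ^ i := by
        rw [Finset.sum_range_succ, hsL]; simp
      have h2 : ∑ i ∈ Finset.range (L + 2), ((s i / Real.sqrt S : ℝ) : ℂ) * (u : ℂ) ^ i
          = u * ∑ i ∈ Finset.range (L + 1),
            ((s (i + 1) / Real.sqrt S : ℝ) : ℂ) * (u : ℂ) ^ i := by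
        rw [Finset.sum_range_succ', hs0, Finset.mul_sum]
        simp only [zero_div, Complex.ofReal_zero, zero_mul, add_zero]
        exact Finset.sum_congr rfl fun m _ => by ring
      simp_rw [sub_div, Complex.ofReal_sub, sub_mul]
      rw [Finset.sum_sub_distrib, h1, h2, one_mul]
    simp_rw [e]
    rw [integral_norm_sq_sum h (fun i => (s (i + 1) - s i) / Real.sqrt S)]
    simp_rw [div_pow, hr]
    rw [← Finset.sum_div]
    have h3 := sum_sin_sq_shift L
    change ∑ m ∈ Finset.range (L + 2), (s (m + 1) - s m) ^ 2
      = 2 * (1 - Real.cos θ) * S at h3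
    rw [h3, mul_div_assoc, div_self hSpos.ne', mul_one]
    have := Real.one_sub_sq_div_two_le_cos (x := θ)
    linarith

/-- On each side of `n`, every distance from `1` to `L` occurs at most once; the diagonal term is `q
0 = 0`. -/
theorem sum_natAbs_sub_le (q : ℕ → ℝ) (hq : ∀ l, 0 ≤ q l) (hq0 : q 0 = 0) {L n : ℕ} (hn : n ≤ L) :
    ∑ m ∈ Finset.range (L + 1), q ((n : ℤ) - m).natAbs ≤ 2 * ∑ l ∈ Finset.Icc 1 L, q l := by
  have h1 : ∑ m ∈ Finset.range n, q ((n : ℤ) - m).natAbs ≤ ∑ l ∈ Finset.Icc 1 L, q l := by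
    rw [← Finset.sum_image (s := Finset.range n) (g := fun m : ℕ => ((n : ℤ) - m).natAbs)]
    · refine Finset.sum_le_sum_of_subset_of_nonneg ?_ fun l _ _ => hq l
      intro l hl
      simp only [Finset.mem_image, Finset.mem_range, Finset.mem_Icc] at hl ⊢
      omega
    · intro a ha b hb hab
      simp only [Finset.coe_range, Set.mem_Iio] at ha hb hab
      omega
  have h2 : ∑ m ∈ Finset.Ico n (L + 1), q ((n : ℤ) - m).natAbs ≤ ∑ l ∈ Finset.Icc 1 L, q l := by
    rw [Finset.sum_eq_sum_Ico_succ_bot (by omega), sub_self, Int.natAbs_zero, hq0, zero_add,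
      ← Finset.sum_image (s := Finset.Ico (n + 1) (L + 1))
        (g := fun m : ℕ => ((n : ℤ) - m).natAbs)]
    · refine Finset.sum_le_sum_of_subset_of_nonneg ?_ fun l _ _ => hq l
      intro l hl
      simp only [Finset.mem_image, Finset.mem_Ico, Finset.mem_Icc] at hl ⊢
      omega
    · intro a ha b hb hab
      simp only [Finset.coe_Ico, Set.mem_Ico] at ha hb hab
      omega
  rw [← Finset.sum_range_add_sum_Ico _ (show n ≤ L + 1 by omega)]
  linarith

/-- Schur's test for a symmetric Toeplitz matrix: `|b n| |b m|` is at most the mean of the squares,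
and all row sums have the same bound. -/
theorem sum_toeplitz_le (q : ℕ → ℝ) (hq : ∀ l, 0 ≤ q l) (hq0 : q 0 = 0) (L : ℕ) (b : ℕ → ℝ) :
    ∑ n ∈ Finset.range (L + 1), ∑ m ∈ Finset.range (L + 1),
        |b n| * |b m| * q ((n : ℤ) - m).natAbs
      ≤ (∑ n ∈ Finset.range (L + 1), b n ^ 2) * (2 * ∑ l ∈ Finset.Icc 1 L, q l) := by
  set R := Finset.range (L + 1)
  have hX : ∑ n ∈ R, ∑ m ∈ R, b n ^ 2 * q ((n : ℤ) - m).natAbs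
      ≤ (∑ n ∈ R, b n ^ 2) * (2 * ∑ l ∈ Finset.Icc 1 L, q l) := by
    rw [Finset.sum_mul]
    refine Finset.sum_le_sum fun n hn => ?_
    rw [← Finset.mul_sum]
    exact mul_le_mul_of_nonneg_left
      (sum_natAbs_sub_le q hq hq0 (Nat.lt_succ_iff.1 (Finset.mem_range.1 hn))) (sq_nonneg _)
  have hY : ∑ n ∈ R, ∑ m ∈ R, b m ^ 2 * q ((n : ℤ) - m).natAbs
      = ∑ n ∈ R, ∑ m ∈ R, b n ^ 2 * q ((n : ℤ) - m).natAbs := by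
    rw [Finset.sum_comm]
    refine Finset.sum_congr rfl fun n _ => Finset.sum_congr rfl fun m _ => ?_
    rw [← Int.natAbs_neg, neg_sub]
  have hZ : ∑ n ∈ R, ∑ m ∈ R, |b n| * |b m| * q ((n : ℤ) - m).natAbs
      ≤ ∑ n ∈ R, ∑ m ∈ R, (b n ^ 2 * q ((n : ℤ) - m).natAbs / 2
        + b m ^ 2 * q ((n : ℤ) - m).natAbs / 2) := by
    refine Finset.sum_le_sum fun n _ => Finset.sum_le_sum fun m _ => ?_
    have h1 : |b n| * |b m| ≤ (b n ^ 2 + b m ^ 2) / 2 := by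
      rw [← sq_abs (b n), ← sq_abs (b m)]
      linarith [two_mul_le_add_sq |b n| |b m|]
    refine (mul_le_mul_of_nonneg_right h1 (hq _)).trans_eq (by ring)
  simp only [Finset.sum_add_distrib, ← Finset.sum_div] at hZ
  linarith

/-- Moments of opposite orders are conjugate, so only nonnegative orders need be controlled. -/
theorem norm_moment_sub_natAbs (μ ν : Measure Circle) (n : ℤ) :
    ‖∫ z, ((z ^ (-n) : Circle) : ℂ) ∂μ - ∫ z, ((z ^ (-n) : Circle) : ℂ) ∂ν‖
      = ‖∫ z, (z : ℂ) ^ n.natAbs ∂μ - ∫ z, (z : ℂ) ^ n.natAbs ∂ν‖ := by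
  have h1 : ∀ m : ℕ, ∀ z : Circle, (z : ℂ) ^ m = ((z ^ (m : ℤ) : Circle) : ℂ) := by
    intro m z
    rw [zpow_natCast, Circle.coe_pow]
  simp_rw [h1]
  rcases Int.natAbs_eq n with h | h
  · rw [integral_conj_zpow, integral_conj_zpow, ← map_sub, RCLike.norm_conj, ← h]
  · rw [show ((n.natAbs : ℕ) : ℤ) = -n by omega]

/-- A Lipschitz function on the circle integrates almost equally against two probability measures
whose moments are close. -/
theorem integral_sub_integral_le (μ ν : Measure Circle) [IsProbabilityMeasure μ]
    [IsProbabilityMeasure ν] {φ : Circle → ℝ} (hφ : LipschitzWith 1 φ) (L : ℕ) :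
    ∫ z, φ z ∂μ - ∫ z, φ z ∂ν ≤ 2 * (Real.pi / (L + 2)) + Real.pi *
      ∑ l ∈ Finset.Icc 1 L, ‖∫ z, (z : ℂ) ^ l ∂μ - ∫ z, (z : ℂ) ^ l ∂ν‖ / l := by
  obtain ⟨h, hinv, hprob⟩ := exists_isMulLeftInvariant_isProbabilityMeasure
  obtain ⟨b, hb1, hb2⟩ := exists_concentrated_coeffs L h
  have hc := hφ.continuous
  set θ : ℝ := Real.pi / (L + 2) with hθ
  have hθpos : 0 < θ := by positivity
  set R := Finset.range (L + 1)
  let k : Circle → ℝ := fun u => ‖∑ i ∈ R, (b i : ℂ) * (u : ℂ) ^ i‖ ^ 2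
  have hk : Continuous k := by fun_prop
  have hk0 : ∀ u, 0 ≤ k u := fun u => by positivity
  have hk1 : ∫ u, k u ∂h = 1 := by rw [← hb1]; exact integral_norm_sq_sum h b (L + 1)
  -- The smoothing of `φ` by the kernel; `c n` are Fourier coefficients of `φ`, and `hσ` exhibits
  -- `σ` as a trigonometric polynomial.
  let σ : Circle → ℝ := fun z => ∫ w, φ w * k (z⁻¹ * w) ∂h
  let c : ℤ → ℂ := fun n => ∫ w, (φ w : ℂ) * ((w ^ n : Circle) : ℂ) ∂h
  have hσ : ∀ z, (σ z : ℂ) = ∑ i ∈ R, ∑ j ∈ R,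
      ((b i * b j : ℂ) * c ((i : ℤ) - j)) * ((z ^ (-((i : ℤ) - j)) : Circle) : ℂ) := by
    intro z
    have e : ∀ w, ((φ w * k (z⁻¹ * w) : ℝ) : ℂ) = ∑ i ∈ R, ∑ j ∈ R,
        ((b i * b j : ℂ) * ((z ^ (-((i : ℤ) - j)) : Circle) : ℂ))
          * ((φ w : ℂ) * ((w ^ ((i : ℤ) - j) : Circle) : ℂ)) := by
      intro w
      rw [Complex.ofReal_mul, norm_sq_sum_eq, Finset.mul_sum]
      refine Finset.sum_congr rfl fun i _ => ?_
      rw [Finset.mul_sum]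
      refine Finset.sum_congr rfl fun j _ => ?_
      rw [mul_zpow, inv_zpow', Circle.coe_mul]
      ring
    have hint : ∀ i j : ℕ, Integrable (fun w : Circle =>
        ((b i * b j : ℂ) * ((z ^ (-((i : ℤ) - j)) : Circle) : ℂ))
          * ((φ w : ℂ) * ((w ^ ((i : ℤ) - j) : Circle) : ℂ))) h := fun i j =>
      integrable_of_continuous_circle (continuous_const.mul
        (Continuous.mul (by fun_prop) (continuous_circle_zpow _))) _
    rw [← integral_complex_ofReal]
    simp_rw [e]
    rw [integral_finsetSum _ fun i _ => integrable_finsetSum _ fun j _ => hint i j]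
    refine Finset.sum_congr rfl fun i _ => ?_
    rw [integral_finsetSum _ fun j _ => hint i j]
    refine Finset.sum_congr rfl fun j _ => ?_
    rw [integral_const_mul]
    ring
  have hσint : ∀ (ρ : Measure Circle) [IsProbabilityMeasure ρ], Integrable σ ρ ∧
      ((∫ z, σ z ∂ρ : ℝ) : ℂ) = ∑ i ∈ R, ∑ j ∈ R, ((b i * b j : ℂ) * c ((i : ℤ) - j))
        * ∫ z, ((z ^ (-((i : ℤ) - j)) : Circle) : ℂ) ∂ρ := by
    intro ρ _
    have hint : ∀ i j : ℕ, Integrable (fun z : Circle => ((b i * b j : ℂ) * c ((i : ℤ) - j))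
        * ((z ^ (-((i : ℤ) - j)) : Circle) : ℂ)) ρ := fun i j =>
      integrable_of_continuous_circle (continuous_const.mul (continuous_circle_zpow _)) _
    have hI : Integrable (fun z => (σ z : ℂ)) ρ := by
      simp_rw [hσ]
      exact integrable_finsetSum _ fun i _ => integrable_finsetSum _ fun j _ => hint i j
    refine ⟨by simpa using hI.re, ?_⟩
    rw [← integral_complex_ofReal]
    simp_rw [hσ]
    rw [integral_finsetSum _ fun i _ => integrable_finsetSum _ fun j _ => hint i j]
    refine Finset.sum_congr rfl fun i _ => ?_
    rw [integral_finsetSum _ fun j _ => hint i j]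
    exact Finset.sum_congr rfl fun j _ => integral_const_mul _ _
  have herr : ∀ z, |φ z - σ z| ≤ θ := by
    intro z
    have hkz : ∫ w, k (z⁻¹ * w) ∂h = 1 := by rw [integral_mul_left_eq_self k, hk1]
    have hm : ∫ w, ‖1 - ((z⁻¹ * w : Circle) : ℂ)‖ ^ 2 * k (z⁻¹ * w) ∂h ≤ θ ^ 2 := by
      rw [integral_mul_left_eq_self (fun u : Circle => ‖1 - (u : ℂ)‖ ^ 2 * k u)]
      exact hb2
    have hkzc : Continuous fun w => k (z⁻¹ * w) := by fun_prop
    have hmc : Continuous fun w : Circle => ‖1 - ((z⁻¹ * w : Circle) : ℂ)‖ ^ 2 * k (z⁻¹ * w) := by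
      have : Continuous fun u : Circle => ‖1 - (u : ℂ)‖ ^ 2 * k u := by fun_prop
      exact this.comp (continuous_const.mul continuous_id)
    have e : φ z - σ z = ∫ w, (φ z - φ w) * k (z⁻¹ * w) ∂h := by
      simp_rw [sub_mul]
      rw [integral_sub, integral_const_mul, hkz, mul_one]
      all_goals exact integrable_of_continuous_circle (by fun_prop) _
    rw [e]
    have hb : ∀ w, ‖(φ z - φ w) * k (z⁻¹ * w)‖ ≤ θ / 2 * k (z⁻¹ * w)
        + 1 / (2 * θ) * (‖1 - ((z⁻¹ * w : Circle) : ℂ)‖ ^ 2 * k (z⁻¹ * w)) := by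
      intro w
      have h1 : |φ z - φ w| ≤ ‖1 - ((z⁻¹ * w : Circle) : ℂ)‖ := by
        have := hφ.dist_le_mul z w
        rw [Real.dist_eq, NNReal.coe_one, one_mul, circle_dist_eq_norm] at this
        have e1 : (z : ℂ) - w = z * (1 - ((z⁻¹ * w : Circle) : ℂ)) := by
          rw [mul_sub, ← Circle.coe_mul, mul_inv_cancel_left, mul_one]
        rwa [e1, norm_mul, Circle.norm_coe, one_mul] at this
      set t := ‖1 - ((z⁻¹ * w : Circle) : ℂ)‖
      -- This inequality replaces Cauchy–Schwarz: integrated against `k`, each of the two terms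
      -- contributes at most `θ / 2`.
      have h2 : t ≤ θ / 2 + 1 / (2 * θ) * t ^ 2 := by
        have : θ / 2 + 1 / (2 * θ) * t ^ 2 - t = (θ - t) ^ 2 / (2 * θ) := by
          field_simp; ring
        have : 0 ≤ (θ - t) ^ 2 / (2 * θ) := by positivity
        linarith
      rw [norm_mul, Real.norm_eq_abs, Real.norm_of_nonneg (hk0 _)]
      refine (mul_le_mul_of_nonneg_right (h1.trans h2) (hk0 _)).trans_eq (by ring)
    have hI1 : Integrable (fun w => θ / 2 * k (z⁻¹ * w)) h :=
      integrable_of_continuous_circle (by fun_prop) _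
    have hI2 : Integrable (fun w => 1 / (2 * θ)
        * (‖1 - ((z⁻¹ * w : Circle) : ℂ)‖ ^ 2 * k (z⁻¹ * w))) h :=
      integrable_of_continuous_circle (continuous_const.mul hmc) _
    have := norm_integral_le_of_norm_le (hI1.add hI2) (Eventually.of_forall hb)
    rw [Real.norm_eq_abs] at this
    refine this.trans ?_
    change ∫ w, (θ / 2 * k (z⁻¹ * w) + 1 / (2 * θ)
        * (‖1 - ((z⁻¹ * w : Circle) : ℂ)‖ ^ 2 * k (z⁻¹ * w))) ∂h ≤ θ
    rw [integral_add hI1 hI2, integral_const_mul, integral_const_mul, hkz]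
    have h3 : 1 / (2 * θ) * ∫ w, ‖1 - ((z⁻¹ * w : Circle) : ℂ)‖ ^ 2 * k (z⁻¹ * w) ∂h
        ≤ 1 / (2 * θ) * θ ^ 2 := mul_le_mul_of_nonneg_left hm (by positivity)
    have h4 : 1 / (2 * θ) * θ ^ 2 = θ / 2 := by field_simp
    linarith
  have happ : ∀ (ρ : Measure Circle) [IsProbabilityMeasure ρ],
      |∫ z, φ z ∂ρ - ∫ z, σ z ∂ρ| ≤ θ := by
    intro ρ _
    rw [← integral_sub (integrable_of_continuous_circle hc ρ) (hσint ρ).1, ← Real.norm_eq_abs]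
    exact (norm_integral_le_of_norm_le_const (C := θ)
      (Eventually.of_forall herr)).trans (by simp)
  let D : ℕ → ℝ := fun l => ‖∫ z, (z : ℂ) ^ l ∂μ - ∫ z, (z : ℂ) ^ l ∂ν‖
  let q : ℕ → ℝ := fun l => Real.pi / (2 * l) * D l
  have hq : ∀ l, 0 ≤ q l := fun l => by positivity
  have hq0 : q 0 = 0 := by simp [q]
  have hcq : ∀ n : ℤ, ‖c n * (∫ z, ((z ^ (-n) : Circle) : ℂ) ∂μ
      - ∫ z, ((z ^ (-n) : Circle) : ℂ) ∂ν)‖ ≤ q n.natAbs := by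
    intro n
    -- The Fourier bound is unavailable at `n = 0`, but there the moments agree because both
    -- measures have mass one.
    by_cases hn : n = 0
    · subst hn
      simp [hq0]
    · rw [norm_mul, norm_moment_sub_natAbs]
      exact mul_le_mul_of_nonneg_right (norm_fourierCoeff_le h hφ hn) (norm_nonneg _)
  have hmain : |∫ z, σ z ∂μ - ∫ z, σ z ∂ν| ≤ 2 * ∑ l ∈ Finset.Icc 1 L, q l := by
    have e : |∫ z, σ z ∂μ - ∫ z, σ z ∂ν| = ‖((∫ z, σ z ∂μ : ℝ) : ℂ) - (∫ z, σ z ∂ν : ℝ)‖ := by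
      rw [← Complex.ofReal_sub, Complex.norm_real, Real.norm_eq_abs]
    rw [e, (hσint μ).2, (hσint ν).2, ← Finset.sum_sub_distrib]
    have h1 := sum_toeplitz_le q hq hq0 L b
    rw [hb1, one_mul] at h1
    refine le_trans ?_ h1
    refine (norm_sum_le _ _).trans (Finset.sum_le_sum fun i _ => ?_)
    rw [← Finset.sum_sub_distrib]
    refine (norm_sum_le _ _).trans (Finset.sum_le_sum fun j _ => ?_)
    rw [← mul_sub, mul_assoc, norm_mul, norm_mul, Complex.norm_real, Complex.norm_real,
      Real.norm_eq_abs, Real.norm_eq_abs]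
    exact mul_le_mul_of_nonneg_left (hcq _) (by positivity)
  have hsum : 2 * ∑ l ∈ Finset.Icc 1 L, q l = Real.pi * ∑ l ∈ Finset.Icc 1 L, D l / l := by
    rw [Finset.mul_sum, Finset.mul_sum]
    refine Finset.sum_congr rfl fun l hl => ?_
    have : (l : ℝ) ≠ 0 := by
      have := (Finset.mem_Icc.1 hl).1
      positivity
    simp only [q]
    field_simp
  rw [hsum] at hmain
  have a1 := abs_le.1 (happ μ)
  have a2 := abs_le.1 (happ ν)
  have a3 := abs_le.1 hmain
  change _ ≤ 2 * θ + Real.pi * ∑ l ∈ Finset.Icc 1 L, D l / l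
  linarith [a1.2, a2.1, a3.2]

end TrigonometricApproximation

/-! ### Moments of the scalar spectral measures. -/

section SpectralMoments

variable {H : Type u} [NormedAddCommGroup H] [InnerProductSpace ℂ H]

/-- Polarization and the parallelogram law control the sesquilinear form by the quadratic form. The
lemma upgrades the diagonal information in `Represents` to operator-norm estimates. -/
theorem norm_le_of_norm_inner_self_le (A : H →L[ℂ] H) {ε : ℝ} (hε : 0 ≤ ε)
    (hA : ∀ x, ‖⟪A x, x⟫‖ ≤ ε * ‖x‖ ^ 2) : ‖A‖ ≤ 2 * ε := by
  have hpol : ∀ x y : H, ‖⟪A y, x⟫‖ ≤ ε * (‖x‖ ^ 2 + ‖y‖ ^ 2) := by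
    intro x y
    have h := inner_map_polarization' (A : H →ₗ[ℂ] H) y x
    simp only [ContinuousLinearMap.coe_coe] at h
    have p1 := parallelogram_law_with_norm ℂ y x
    have p2 := parallelogram_law_with_norm ℂ y (Complex.I • x)
    rw [norm_smul, Complex.norm_I, one_mul] at p2
    have hI : ∀ v : ℂ, ‖Complex.I * v‖ = ‖v‖ := fun v => by simp
    rw [h, norm_div, Complex.norm_ofNat, div_le_iff₀ (by norm_num)]
    refine (norm_add_le _ _).trans ?_
    refine (add_le_add ((norm_sub_le _ _).trans
      (add_le_add (norm_sub_le _ _) le_rfl)) le_rfl).trans ?_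
    rw [hI, hI]
    nlinarith [hA (y + x), hA (y - x), hA (y + Complex.I • x), hA (y - Complex.I • x)]
  refine A.opNorm_le_bound (by positivity) fun y => ?_
  by_cases hy : ‖A y‖ = 0
  · rw [hy]; positivity
  have hy' : 0 < ‖A y‖ := lt_of_le_of_ne (norm_nonneg _) (Ne.symm hy)
  have hy0 : 0 < ‖y‖ := norm_pos_iff.2 fun h => by simp [h] at hy
  -- The test vector is `A y` rescaled to norm `‖y‖`, which gives the factor `2`.
  have h := hpol (((‖y‖ / ‖A y‖ : ℝ) : ℂ) • A y) y
  rw [inner_smul_right, inner_self_eq_norm_sq_to_K, norm_smul, norm_mul, Complex.norm_real,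
    Real.norm_of_nonneg (by positivity), div_mul_cancel₀ _ hy, norm_pow] at h
  simp only [Complex.coe_algebraMap, Complex.norm_real, norm_norm] at h
  have e : ‖y‖ / ‖A y‖ * ‖A y‖ ^ 2 = ‖y‖ * ‖A y‖ := by field_simp
  rw [e] at h
  nlinarith

/-- The identity map of the circle is a uniform limit of simple functions. -/
theorem exists_simpleFunc_dist_lt {ε : ℝ} (hε : 0 < ε) :
    ∃ s : SimpleFunc Circle Circle, ∀ z, dist (s z) z < ε := by
  obtain ⟨t, -, ht, hcov⟩ := (isCompact_univ (X := Circle)).finite_cover_balls hε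
  let l := ht.toFinset.toList
  -- `nearestPt e l.length` also considers the index `l.length`, where the default `1` is read; an
  -- extra candidate is harmless.
  let e : ℕ → Circle := fun n => l.getD n 1
  refine ⟨SimpleFunc.nearestPt e l.length, fun z => ?_⟩
  obtain ⟨y, hy, hz⟩ := Set.mem_iUnion₂.1 (hcov (Set.mem_univ z))
  have hyl : y ∈ l := Finset.mem_toList.2 (ht.mem_toFinset.2 hy)
  obtain ⟨k, hk, hky⟩ := List.getElem_of_mem hyl
  have h1 := SimpleFunc.edist_nearestPt_le e z hk.le
  have h2 : e k = y := by simp [e, hk, hky]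
  rw [h2, edist_dist, edist_dist, ENNReal.ofReal_le_ofReal_iff dist_nonneg] at h1
  exact h1.trans_lt (by rw [dist_comm]; exact hz)

namespace OperatorMeasure

theorem scalar_apply (E : OperatorMeasure H) (x : H) {S : Set Circle} (hS : MeasurableSet S) :
    E.scalar x S = ENNReal.ofReal (⟪x, E.toFun S x⟫).re :=
  Measure.ofMeasurable_apply _ hS

theorem scalar_univ (E : OperatorMeasure H) (x : H) :
    E.scalar x Set.univ = ENNReal.ofReal (‖x‖ ^ 2) := by
  rw [scalar_apply _ _ .univ, E.map_univ, one_apply_eq_self, inner_self_eq_norm_sq_to_K]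
  congr 1
  norm_cast

instance isFiniteMeasure_scalar (E : OperatorMeasure H) (x : H) : IsFiniteMeasure (E.scalar x) :=
  ⟨by rw [scalar_univ]; exact ENNReal.ofReal_lt_top⟩

theorem inner_apply_eq_scalar [CompleteSpace H] (E : OperatorMeasure H) (x : H) {S : Set Circle}
    (hS : MeasurableSet S) : ⟪x, E.toFun S x⟫ = ((E.scalar x).real S : ℂ) := by
  have hp := E.isPositive S hS
  rw [Measure.real, scalar_apply _ _ hS, ENNReal.toReal_ofReal
    (show 0 ≤ (⟪x, E.toFun S x⟫).re from hp.re_inner_nonneg_right x)]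
  have := hp.isSelfAdjoint
  have hs := (ContinuousLinearMap.isSelfAdjoint_iff_isSymmetric.1 this)
  have := hs.coe_re_inner_self_apply x
  simp only [ContinuousLinearMap.coe_coe] at this
  exact this.symm

theorem apply_union [CompleteSpace H] (E : OperatorMeasure H) {S R : Set Circle}
    (hS : MeasurableSet S) (hR : MeasurableSet R) (hd : Disjoint S R) :
    E.toFun (S ∪ R) = E.toFun S + E.toFun R := by
  refine eq_of_inner_self_eq fun x => ?_
  rw [add_apply, inner_add_right, inner_apply_eq_scalar _ _ hS, inner_apply_eq_scalar _ _ hR,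
    inner_apply_eq_scalar _ _ (hS.union hR), measureReal_union hd hR, Complex.ofReal_add]

/-- Additivity makes `P + Q` idempotent, so `PQ + QP = 0`. Multiplying by `P` on either side gives
`PQ = -PQP = QP`, whence `2PQ = 0`. -/
theorem IsProjectionValued.apply_mul_apply [CompleteSpace H] {E : OperatorMeasure H}
    (hE : E.IsProjectionValued) {S R : Set Circle}
    (hS : MeasurableSet S) (hR : MeasurableSet R) (hd : Disjoint S R) :
    E.toFun S * E.toFun R = 0 := by
  have hP := (hE S hS).isIdempotentElem
  have hQ := (hE R hR).isIdempotentElem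
  have hPQ := (hE _ (hS.union hR)).isIdempotentElem
  rw [E.apply_union hS hR hd] at hPQ
  set P := E.toFun S
  set Q := E.toFun R
  have h1 : P * Q + Q * P = 0 := (hP.add_iff hQ).1 hPQ
  have h2 : P * Q + P * Q * P = 0 := by
    have := congrArg (P * ·) h1
    simpa [mul_add, ← mul_assoc, hP.eq] using this
  have h3 : P * Q * P + Q * P = 0 := by
    have := congrArg (· * P) h1
    simpa [add_mul, mul_assoc, hP.eq] using this
  have h4 : P * Q = Q * P := by
    rw [eq_neg_of_add_eq_zero_left h2, eq_neg_of_add_eq_zero_right h3]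
  rw [← h4, ← two_smul ℂ] at h1
  exact (smul_eq_zero.1 h1).resolve_left two_ne_zero

/-- The operator `∫ s dE` for a simple function `s`, raised to a power. -/
def simpleIntegral (E : OperatorMeasure H) (s : SimpleFunc Circle Circle) (l : ℕ) : H →L[ℂ] H :=
  ∑ c ∈ s.range, (c : ℂ) ^ l • E.toFun (s ⁻¹' {c})

theorem inner_simpleIntegral [CompleteSpace H] (E : OperatorMeasure H)
    (s : SimpleFunc Circle Circle) (l : ℕ) (x : H) :
    ⟪x, E.simpleIntegral s l x⟫ = ∫ z, (s z : ℂ) ^ l ∂(E.scalar x) := by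
  have e : ∀ z, (s z : ℂ) ^ l
      = ∑ c ∈ s.range, (s ⁻¹' {c}).indicator (fun _ => (c : ℂ) ^ l) z := by
    intro z
    rw [Finset.sum_eq_single (s z)]
    · rw [Set.indicator_of_mem (by simp)]
    · intro c _ hc
      exact Set.indicator_of_notMem (by simpa using hc.symm) _
    · exact fun h => absurd (SimpleFunc.mem_range_self s z) h
  simp_rw [e]
  rw [integral_finsetSum _ fun c _ => (integrable_const _).indicator (s.measurableSet_fiber c)]
  simp only [simpleIntegral, sum_apply, smul_apply, inner_sum, inner_smul_right]
  refine Finset.sum_congr rfl fun c _ => ?_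
  rw [E.inner_apply_eq_scalar x (s.measurableSet_fiber c),
    integral_indicator_const _ (s.measurableSet_fiber c), Complex.real_smul, mul_comm]

theorem simpleIntegral_zero [CompleteSpace H] (E : OperatorMeasure H)
    (s : SimpleFunc Circle Circle) : E.simpleIntegral s 0 = 1 := by
  refine eq_of_inner_self_eq fun x => ?_
  rw [inner_simpleIntegral, ← E.map_univ, E.inner_apply_eq_scalar x .univ]
  simp

/-- Distinct fibres are disjoint, so the cross terms vanish and the diagonal ones are idempotent. -/
theorem simpleIntegral_eq_pow [CompleteSpace H] {E : OperatorMeasure H}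
    (hE : E.IsProjectionValued) (s : SimpleFunc Circle Circle) (l : ℕ) :
    E.simpleIntegral s l = E.simpleIntegral s 1 ^ l := by
  induction l with
  | zero => rw [simpleIntegral_zero, pow_zero]
  | succ l ih =>
    rw [pow_succ, ← ih]
    simp only [simpleIntegral, pow_one]
    rw [Finset.sum_mul_sum]
    refine Finset.sum_congr rfl fun c hc => ?_
    rw [Finset.sum_eq_single c]
    · rw [smul_mul_smul_comm, (hE _ (s.measurableSet_fiber c)).isIdempotentElem.eq, pow_succ]
    · intro d _ hdc
      rw [smul_mul_smul_comm, hE.apply_mul_apply (s.measurableSet_fiber c)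
        (s.measurableSet_fiber d), smul_zero]
      exact Disjoint.preimage _ (Set.disjoint_singleton.2 hdc.symm)
    · exact fun h => absurd hc h

/-- The moments of the spectral measure of an operator are given by its powers. -/
theorem IsProjectionValued.inner_pow_apply [CompleteSpace H] {E : OperatorMeasure H}
    (hE : E.IsProjectionValued) {T : H →L[ℂ] H} (hT : E.Represents T) (l : ℕ) (x : H) :
    ⟪x, (T ^ l) x⟫ = ∫ z, (z : ℂ) ^ l ∂(E.scalar x) := by
  let δ : ℕ → ℝ := fun n => 1 / ((n : ℝ) + 1)
  have hδ : ∀ n, 0 < δ n := fun n => Nat.one_div_pos_of_nat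
  have hδ0 : Tendsto δ atTop (𝓝 0) := tendsto_one_div_add_atTop_nhds_zero_nat
  choose s hs using fun n => exists_simpleFunc_dist_lt (hδ n)
  -- Weak convergence would not pass to powers; convergence in norm does.
  have hnorm : ∀ n, ‖E.simpleIntegral (s n) 1 - T‖ ≤ 2 * δ n := by
    intro n
    refine norm_le_of_norm_inner_self_le _ (hδ n).le fun y => ?_
    rw [← inner_conj_symm, RCLike.norm_conj, sub_apply, inner_sub_right, inner_simpleIntegral,
      hT y, ← integral_sub]
    · refine (norm_integral_le_of_norm_le_const (C := δ n) (Eventually.of_forall fun z => ?_)).trans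
        (le_of_eq ?_)
      · rw [pow_one, ← circle_dist_eq_norm]
        exact (hs n z).le
      · rw [Measure.real, scalar_univ, ENNReal.toReal_ofReal (by positivity)]
    · exact Integrable.of_bound (by fun_prop) 1 (Eventually.of_forall fun z => by
        rw [pow_one, Circle.norm_coe])
    · exact Integrable.of_bound (by fun_prop) 1 (Eventually.of_forall fun z =>
        (Circle.norm_coe z).le)
  have hlimT : Tendsto (fun n => E.simpleIntegral (s n) 1) atTop (𝓝 T) := by
    rw [tendsto_iff_norm_sub_tendsto_zero]
    exact squeeze_zero (fun _ => norm_nonneg _) hnorm (by simpa using hδ0.const_mul 2)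
  have h1 : Tendsto (fun n => ⟪x, E.simpleIntegral (s n) l x⟫) atTop (𝓝 ⟪x, (T ^ l) x⟫) := by
    simp_rw [simpleIntegral_eq_pow hE _ l]
    have hc : Continuous fun A : H →L[ℂ] H => ⟪x, (A ^ l) x⟫ := by fun_prop
    exact (hc.tendsto T).comp hlimT
  refine tendsto_nhds_unique h1 ?_
  simp_rw [inner_simpleIntegral]
  refine tendsto_integral_of_dominated_convergence (fun _ => 1) (fun n => by fun_prop)
    (integrable_const _) (fun n => Eventually.of_forall fun z => by
      rw [norm_pow, Circle.norm_coe, one_pow])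
    (Eventually.of_forall fun z => ?_)
  have hz : Tendsto (fun n => s n z) atTop (𝓝 z) := by
    rw [tendsto_iff_dist_tendsto_zero]
    exact squeeze_zero (fun _ => dist_nonneg) (fun n => (hs n z).le) hδ0
  have hc : Continuous fun u : Circle => (u : ℂ) ^ l := by fun_prop
  exact (hc.tendsto z).comp hz

theorem scalar_compress {H' : Type u} [NormedAddCommGroup H'] [InnerProductSpace ℂ H']
    [CompleteSpace H] [CompleteSpace H'] (E' : OperatorMeasure H') (ι : H →ₗᵢ[ℂ] H') (x : H) :
    (E'.compress ι).scalar x = E'.scalar (ι x) := by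
  refine Measure.ext fun S hS => ?_
  rw [scalar_apply _ _ hS, scalar_apply _ _ hS]
  simp [compress, ContinuousLinearMap.adjoint_inner_right]

end OperatorMeasure

variable [CompleteSpace H]

theorem isProbabilityMeasure_scalarSpectralMeasure (K : H →ₗᵢ[ℂ] H) {g : H} (hg : ‖g‖ = 1) :
    IsProbabilityMeasure (scalarSpectralMeasure K g) :=
  ⟨by rw [scalarSpectralMeasure, OperatorMeasure.scalar_univ, hg]; simp⟩

/-- The compressed measure need not be projection-valued, so the moment is computed at `ι g` in the
extension, where `K' ^ l` restricts to `K ^ l`. -/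
theorem integral_pow_scalarSpectralMeasure (K : H →ₗᵢ[ℂ] H) (g : H) (l : ℕ) :
    ∫ z, (z : ℂ) ^ l ∂(scalarSpectralMeasure K g) = ⟪g, (K ^ l) g⟫ := by
  obtain ⟨H', _, _, _, ι, K', E', hK, hE, hR, hEq⟩ := (exists_isSpectralMeasure K).choose_spec
  have h : scalarSpectralMeasure K g = E'.scalar (ι g) := by
    rw [← OperatorMeasure.scalar_compress, ← hEq]
    rfl
  rw [h, ← hE.inner_pow_apply hR l (ι g)]
  have hpow : ∀ (l : ℕ), ((K' : H' →L[ℂ] H') ^ l) (ι g) = ι ((K ^ l) g) := by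
    intro l
    induction l with
    | zero => simp
    | succ l ih =>
      rw [pow_succ', pow_succ', mul_apply_eq_comp, ih]
      exact hK _
  rw [hpow, ι.inner_map_map]

end SpectralMoments

/-! ### Moments of the mpEDMD measure. -/

section MatrixMoments

variable {Ω : Type u} {N M : ℕ}

open scoped MatrixOrder ComplexOrder

theorem posSemidef_gramMatrix (ψ : Fin N → Ω → ℂ) (x : Fin M → Ω) {w : Fin M → ℝ}
    (hw : ∀ m, 0 ≤ w m) : (gramMatrix ψ x w).PosSemidef := by
  have h : (weightMatrix w).PosSemidef :=
    Matrix.PosSemidef.diagonal fun m => by simpa using hw m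
  exact h.conjTranspose_mul_mul_same _

/-- The diagonal matrix is a product of unitaries, hence unitary. This places the atoms on the
circle. -/
theorem norm_eigenvalue_eq_one {U Vhat : Matrix (Fin N) (Fin N) ℂ} {lam : Fin N → ℂ}
    (hU : U ∈ Matrix.unitaryGroup (Fin N) ℂ) (hV : Vhat ∈ Matrix.unitaryGroup (Fin N) ℂ)
    (h : U = Vhat * Matrix.diagonal lam * Vhat.conjTranspose) (j : Fin N) : ‖lam j‖ = 1 := by
  have hV1 : Vhat.conjTranspose * Vhat = 1 := Matrix.mem_unitaryGroup_iff'.1 hV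
  have hd : Matrix.diagonal lam = Vhat.conjTranspose * U * Vhat := by
    rw [h]
    calc _ = 1 * Matrix.diagonal lam * 1 := by simp
      _ = _ := by rw [← hV1]; simp only [Matrix.mul_assoc]
  have hD : Matrix.diagonal lam ∈ Matrix.unitaryGroup (Fin N) ℂ := by
    rw [hd]
    exact mul_mem (mul_mem (Unitary.star_mem hV) hU) hV
  have h2 := Matrix.mem_unitaryGroup_iff.1 hD
  have h3 := congrFun (congrFun h2 j) j
  rw [Matrix.star_eq_conjTranspose, Matrix.diagonal_conjTranspose, Matrix.diagonal_mul_diagonal,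
    Matrix.diagonal_apply_eq, Matrix.one_apply_eq, Pi.star_apply, RCLike.star_def,
    Complex.mul_conj'] at h3
  have h4 : ‖lam j‖ ^ 2 = 1 := by exact_mod_cast h3
  exact (pow_eq_one_iff_of_nonneg (norm_nonneg _) two_ne_zero).1 h4

theorem star_dotProduct_conj_mulVec (P : Matrix (Fin N) (Fin N) ℂ) (d : Fin N → ℂ)
    (v : Fin N → ℂ) :
    star v ⬝ᵥ (P.conjTranspose * Matrix.diagonal d * P).mulVec v
      = ∑ j, ((‖P.mulVec v j‖ ^ 2 : ℝ) : ℂ) * d j := by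
  rw [← Matrix.mulVec_mulVec, ← Matrix.mulVec_mulVec, Matrix.dotProduct_mulVec,
    ← Matrix.star_mulVec, dotProduct]
  refine Finset.sum_congr rfl fun j _ => ?_
  rw [Matrix.mulVec_diagonal, Complex.ofReal_pow, ← Complex.conj_mul', Pi.star_apply,
    RCLike.star_def]
  ring

/-- When all atoms lie on the circle, restricting the measure from `ℂ` loses no mass. -/
theorem mpEDMDMeasure_eq_sum (G V : Matrix (Fin N) (Fin N) ℂ) (z : Fin N → Circle)
    (gv : Fin N → ℂ) :
    mpEDMDMeasure G V (fun j => (z j : ℂ)) gv = ∑ j, ENNReal.ofReal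
      (‖star (fun i => V i j) ⬝ᵥ G.mulVec gv‖ ^ 2) • Measure.dirac (z j) := by
  have hc : Continuous fun u : Circle => (u : ℂ) := by fun_prop
  have he : MeasurableEmbedding fun u : Circle => (u : ℂ) :=
    (hc.isClosedEmbedding Circle.coe_injective).measurableEmbedding
  refine Measure.ext fun S hS => ?_
  refine (he.comap_apply _ S).trans ?_
  rw [Measure.finsetSum_apply, Measure.finsetSum_apply]
  refine Finset.sum_congr rfl fun j _ => ?_
  rw [Measure.smul_apply, Measure.smul_apply, Measure.dirac_apply' _ hS,
    Measure.dirac_apply' _ (he.measurableSet_image.2 hS)]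
  congr 1
  by_cases h : z j ∈ S
  · rw [Set.indicator_of_mem h, Set.indicator_of_mem (Set.mem_image_of_mem _ h)]
    rfl
  · rw [Set.indicator_of_notMem h, Set.indicator_of_notMem]
    rintro ⟨y, hy, hyz⟩
    exact h (Circle.coe_injective hyz ▸ hy)

theorem integral_sum_smul_dirac (a : Fin N → ℝ) (ha : ∀ j, 0 ≤ a j) (z : Fin N → Circle)
    {f : Circle → ℂ} (hf : Continuous f) :
    ∫ u, f u ∂(∑ j, ENNReal.ofReal (a j) • Measure.dirac (z j)) = ∑ j, (a j : ℂ) * f (z j) := by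
  rw [integral_finsetSum_measure]
  · refine Finset.sum_congr rfl fun j _ => ?_
    rw [integral_smul_measure, integral_dirac, ENNReal.toReal_ofReal (ha j), Complex.real_smul]
  · intro j _
    exact (integrable_of_continuous_circle hf _).smul_measure ENNReal.ofReal_ne_top

/-- The moments of the mpEDMD measure are given by the powers of the mpEDMD matrix. -/
theorem mpEDMD_moments {G A 𝕂 V : Matrix (Fin N) (Fin N) ℂ} {lam : Fin N → ℂ}
    (hG : G.PosSemidef) (hu : IsUnit G) (hout : IsMpEDMDOutput G A 𝕂 V lam) (gv : Fin N → ℂ)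
    (l : ℕ) :
    ∫ z, (z : ℂ) ^ l ∂(mpEDMDMeasure G V lam gv) = star gv ⬝ᵥ (G * 𝕂 ^ l).mulVec gv := by
  obtain ⟨U₁, U₂, Vhat, σ, hU₁, hU₂, hVhat, -, -, hU, hK, hV⟩ := hout
  set Q := CFC.sqrt G with hQ
  have hQQ : Q * Q = G := CFC.sqrt_mul_sqrt_self G hG.nonneg
  have hQs : Q.conjTranspose = Q :=
    (IsSelfAdjoint.of_nonneg (CFC.sqrt_nonneg G) : IsSelfAdjoint Q)
  have hQu : IsUnit Q.det := by
    have h1 : IsUnit (Q * Q) := by rw [hQQ]; exact hu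
    rw [Matrix.isUnit_iff_isUnit_det, Matrix.det_mul] at h1
    exact isUnit_of_mul_isUnit_left h1
  have hQi : Q⁻¹ * Q = 1 := Matrix.nonsing_inv_mul _ hQu
  have hQi' : Q * Q⁻¹ = 1 := Matrix.mul_nonsing_inv _ hQu
  have hnorm : ∀ j, ‖lam j‖ = 1 := norm_eigenvalue_eq_one
    (mul_mem hU₂ (Unitary.star_mem hU₁)) hVhat hU
  let z : Fin N → Circle := fun j => ⟨lam j, by simpa [Submonoid.unitSphere] using hnorm j⟩
  have hz : lam = fun j => (z j : ℂ) := rfl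
  have hVV : Vhat.conjTranspose * Vhat = 1 := Matrix.mem_unitaryGroup_iff'.1 hVhat
  have hVV' : Vhat * Vhat.conjTranspose = 1 := Matrix.mem_unitaryGroup_iff.1 hVhat
  -- As `𝕂 = Q⁻¹ V̂ Λ V̂* Q` and `G = Q * Q`, the powers telescope to `(V̂* Q)* Λ^l (V̂* Q)`. By
  -- `hcoef`, the coordinates of `V̂* Q gv` are the `v_j* G gv` whose squared moduli weight the
  -- atoms.
  have hpow : ∀ l : ℕ, G * 𝕂 ^ l
      = (Vhat.conjTranspose * Q).conjTranspose * Matrix.diagonal (fun j => lam j ^ l)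
        * (Vhat.conjTranspose * Q) := by
    intro l
    rw [Matrix.conjTranspose_mul, Matrix.conjTranspose_conjTranspose, hQs]
    induction l with
    | zero =>
      have : (Matrix.diagonal fun j => lam j ^ 0) = (1 : Matrix (Fin N) (Fin N) ℂ) := by simp
      rw [this, pow_zero, mul_one, mul_one]
      calc G = Q * 1 * Q := by rw [mul_one, hQQ]
        _ = _ := by rw [← hVV']; simp only [Matrix.mul_assoc]
    | succ l ih =>
      have hd : (Matrix.diagonal fun j => lam j ^ (l + 1))
          = (Matrix.diagonal fun j => lam j ^ l) * Matrix.diagonal lam := by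
        rw [Matrix.diagonal_mul_diagonal]
        simp only [pow_succ]
      rw [pow_succ, ← mul_assoc, ih, hK, hU, hd]
      calc _ = Q * Vhat * Matrix.diagonal (fun j => lam j ^ l) * (Vhat.conjTranspose * (Q * Q⁻¹)
              * Vhat) * Matrix.diagonal lam * (Vhat.conjTranspose * Q) := by
            simp only [Matrix.mul_assoc]
        _ = _ := by rw [hQi', mul_one, hVV, mul_one]; simp only [Matrix.mul_assoc]
  have hcoef : ∀ j, star (fun i => V i j) ⬝ᵥ G.mulVec gv
      = (Vhat.conjTranspose * Q).mulVec gv j := by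
    intro j
    have h1 : Vhat.conjTranspose * Q = V.conjTranspose * G := by
      have hQis : (Q⁻¹).conjTranspose = Q⁻¹ := by rw [Matrix.conjTranspose_nonsing_inv, hQs]
      rw [hV, Matrix.conjTranspose_mul, hQis, ← hQQ]
      calc _ = Vhat.conjTranspose * (1 * Q) := by rw [one_mul]
        _ = _ := by rw [← hQi]; simp only [Matrix.mul_assoc]
    rw [h1, ← Matrix.mulVec_mulVec]
    rfl
  rw [hpow, star_dotProduct_conj_mulVec, hz, mpEDMDMeasure_eq_sum,
    integral_sum_smul_dirac _ (fun j => by positivity) _ (by fun_prop)]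
  simp_rw [hcoef]

end MatrixMoments

end MpEDMD

end

/-! ### The Wasserstein bound. -/

theorem theorem5p4 :
    ∃ C : ℝ, 0 < C ∧
      ∀ (Ω : Type*) [MeasurableSpace Ω] (ω : Measure Ω) (F : Ω → Ω)
        (hF : MeasurePreserving F ω ω)
        (N M : ℕ) (ψ : Fin N → Ω → ℂ) (_ : ∀ j, MemLp (ψ j) 2 ω)
        (x : Fin M → Ω) (w : Fin M → ℝ) (_ : ∀ m, 0 ≤ w m)
        (G A 𝕂 V : Matrix (Fin N) (Fin N) ℂ) (lam : Fin N → ℂ)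
        (_ : G = gramMatrix ψ x w) (_ : IsUnit G)
        (_ : A = crossMatrix ψ x (fun m => F (x m)) w)
        (_ : IsMpEDMDOutput G A 𝕂 V lam)
        (L : ℕ) (_ : 2 ≤ L)
        (g : Lp ℂ 2 ω) (_ : ‖g‖ = 1)
        (gv : Fin N → ℂ) (_ : star gv ⬝ᵥ G.mulVec gv = 1),
        W1 (scalarSpectralMeasure (koopman hF) g) (mpEDMDMeasure G V lam gv) ≤
          ((C * (Real.log L / L +
            ∑ l ∈ Finset.Icc 1 L,
              ‖inner ℂ g (((koopman hF) ^ l) g) - star gv ⬝ᵥ (G * 𝕂 ^ l).mulVec gv‖ / l) : ℝ)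
            : EReal) := by
  -- The constant must dominate `π` and satisfy `2π ≤ C log L`; for `L ≥ 2`, `10 · 0.69` exceeds
  -- `2π`.
  refine ⟨10, by norm_num, ?_⟩
  intro Ω _ ω F hF N M ψ _ x w hw G A 𝕂 V lam hGe hu _ hout L hL g hg gv hgv
  have hmom := mpEDMD_moments (hGe ▸ posSemidef_gramMatrix ψ x hw) hu hout gv
  have hμ := isProbabilityMeasure_scalarSpectralMeasure (koopman hF) hg
  -- The total mass is the zeroth moment, which the normalization of `gv` makes equal to one.
  have hν : IsProbabilityMeasure (mpEDMDMeasure G V lam gv) := by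
    have h0 := hmom 0
    simp only [pow_zero, mul_one, hgv, integral_const, Complex.real_smul] at h0
    have h1 : (mpEDMDMeasure G V lam gv).real Set.univ = 1 := by exact_mod_cast h0
    exact ⟨(ENNReal.toReal_eq_one_iff _).1 h1⟩
  refine iSup₂_le fun φ hφ => EReal.coe_le_coe_iff.2 ?_
  refine (integral_sub_integral_le _ _ hφ L).trans ?_
  simp_rw [integral_pow_scalarSpectralMeasure, hmom]
  rw [mul_add]
  have hLr : (2 : ℝ) ≤ L := by exact_mod_cast hL
  have hpi := Real.pi_lt_d2
  refine add_le_add ?_ (mul_le_mul_of_nonneg_right (by linarith)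
    (Finset.sum_nonneg fun l _ => by positivity))
  have hlog : (0.69 : ℝ) ≤ Real.log L :=
    (by linarith [Real.log_two_gt_d9] : (0.69 : ℝ) ≤ Real.log 2).trans
      (Real.log_le_log (by norm_num) hLr)
  calc 2 * (Real.pi / (L + 2)) ≤ 2 * (Real.pi / L) := by gcongr; linarith
    _ = (2 * Real.pi) / L := by ring
    _ ≤ (10 * Real.log L) / L :=
      div_le_div_of_nonneg_right (by linarith) (by positivity)
    _ = 10 * (Real.log L / L) := by ring
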